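/- **Setting.** Let $D=\{(x_j,y_j)\}_{j=1}^N$ with $N\ge 1$, $x_j\in\mathbb R^p$, $y_j\in\mathbb R^d$. Let parameters range over a finite-dimensional Euclidean space $\Theta$ (for instance matrices with the Frobenius norm). Let $\ell(\theta;x,y)$ be a real loss, $r(\theta)$ a real regularizer and $\lambda>0$, and fix $i\in\{1,\dots,N\}$. Put $$f_D(\theta)=\sum_{j=1}^N\ell(\theta;x_j,y_j)+\lambda r(\theta),\qquad f_{D^{-i}}(\theta)=\sum_{j\ne i}\ell(\theta;x_j,y_j)+\lambda r(\theta).$$ Assume that $f_D$ and $f_{D^{-i}}$ are differentiable, $m$-strongly convex and $L$-smooth ($m,L>0$), let $0<\eta<2/L$ and $c=\max\{|1-\eta m|,|1-\eta L|\}$ (for $\eta=1/L$ and $\Theta\neq\{0\}$ this is $c=1-\eta m<1$). Let $\sigma_{\rm learn},\sigma_{\rm unlearn}>0$, let $T,K\ge 0$ be integers and let $\theta_0\in\Theta$ be deterministic. **Trajectories.** Let $\xi_0,\xi_1,\dots$ be i.i.d. $\mathcal N(0,I)$ and $$\theta_{k+1}=\theta_k-\eta\nabla f_D(\theta_k)+\sqrt{2\eta\sigma_{\rm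 learn}^2}\,\xi_k\quad(0\le k<T),\qquad \theta_{k+1}=\theta_k-\eta\nabla f_{D^{-i}}(\theta_k)+\sqrt{2\eta\sigma_{\rm unlearn}^2}\,\xi_k\quad(T\le k<T+K).$$ The retraining trajectory $(\theta'_k)$ starts at $\theta'_0=\theta_0$ and follows the same recursion with $f_D$ replaced by $f_{D^{-i}}$, driven by i.i.d. noises $\xi'_k\sim\mathcal N(0,I)$. Let $\mathcal A(D)$ be the output law of the $T$ learning steps on $D$ from $\theta_0$, and let $\mathcal U(\theta,D^{-i},\cdot)$ be the output law of the $K$ unlearning steps on $D^{-i}$ from $\theta$ (the forget argument is not used); $\mathcal A(D^{-i})$ is defined likewise with $D^{-i}$ in place of $D$. **GDP.** For probability measures $P,Q$ and $\alpha\in[0,1]$ let $\mathcal T(P,Q)(\alpha)=\inf\{\mathbb E_Q[1-\phi]:\ \phi\text{ a measurable }[0,1]\text{-valued test},\ \mathbb E_P[\phi]\le\alpha\}$, and let $G(\mu)=\mathcal T(\mathcal N(0,1),\mathcal N(\mu,1))$. Two random outputs with laws $P,Q$ satisfy $\mu$-GDP if $\mathcal T(P,Q)\ge G(\mu)$ and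 $\mathcal T(Q,P)\ge G(\mu)$ on $[0,1]$. For $\delta\in(0,1)$, $\varepsilon_{\rm GDP}(\mu,\delta)$ is the unique real $\varepsilon$ with $$\delta=\Phi\Bigl(-\frac{\varepsilon}{\mu}+\frac{\mu}{2}\Bigr)-e^{\varepsilon}\,\Phi\Bigl(-\frac{\varepsilon}{\mu}-\frac{\mu}{2}\Bigr),$$ $\Phi$ being the standard normal distribution function; for $\mu=0$ the right-hand side is read as its limit $\max(0,1-e^{\varepsilon})$ as $\mu\to0^+$. **Statement.** The per-instance sensitivity satisfies, for every $\theta$, $\|\eta(\nabla f_{D^{-i}}(\theta)-\nabla f_D(\theta))\|=\eta\|\nabla\ell(\theta;x_i,y_i)\|$. Write $\Delta_{i,k}$ for its value at $\theta=\theta_k$ and suppose that there are deterministic $s_{i,0},\dots,s_{i,T}$ with $\Delta_{i,k}\le s_{i,k}$ almost surely for all $0\le k\le T$. Put $$\mu=\frac{\sum_{k=0}^{T}c^{T+K-k}s_{i,k}}{\sqrt{V_{\rm learn}+V_{\rm unlearn}}},\qquad V_{\rm learn}=\sum_{k=0}^{T}2\eta\sigma_{\rm learn}^2c^{2(T+K-k)},\qquad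 V_{\rm unlearn}=\sum_{k=T+1}^{T+K}2\eta\sigma_{\rm unlearn}^2c^{2(T+K-k)}$$ (with $0^0=1$). Then $\theta_{T+K}$ and $\theta'_{T+K}$ satisfy $\mu$-GDP. Moreover, for every $\delta\in(0,1)$ the number $\varepsilon=\varepsilon_{\rm GDP}(\mu,\delta)$ exists and is unique, and $\mathcal U$ achieves $(\varepsilon,\delta)$-per-instance unlearning of $(x_i,y_i)$: for every measurable $S$, $$\mathbb P\bigl(\mathcal U(\mathcal A(D),D^{-i},(x_i,y_i))\in S\bigr)\le e^{\varepsilon}\,\mathbb P\bigl(\mathcal U(\mathcal A(D^{-i}),D^{-i},\varnothing)\in S\bigr)+\delta.$$ -/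

import Mathlib

open MeasureTheory ProbabilityTheory
open scoped Gradient

noncomputable section

/-! ### Hypothesis tests and Gaussian differential privacy -/

/-- A (possibly randomized) test: `φ x` is the probability of the decision `1` on the data `x`. -/
def IsTest {X : Type*} [MeasurableSpace X] (φ : X → ℝ) : Prop :=
  Measurable φ ∧ ∀ x, 0 ≤ φ x ∧ φ x ≤ 1

/-- The trade-off function `𝒯(P, Q)(α)`: the smallest type II error `P_Q(φ = 0)` of a
(randomized) test `φ` whose type I error `P_P(φ = 1)` is at most `α`. -/
def tradeOff {X : Type*} [MeasurableSpace X] (P Q : Measure X) (α : ℝ) : ℝ :=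
  sInf {β : ℝ | ∃ φ : X → ℝ, IsTest φ ∧ ∫ x, φ x ∂P ≤ α ∧ β = ∫ x, (1 - φ x) ∂Q}

/-- The Gaussian trade-off function `G(μ)`, between `𝒩(0, 1)` and `𝒩(μ, 1)`. -/
def gaussianTradeOff (μ : ℝ) (α : ℝ) : ℝ :=
  tradeOff (gaussianReal 0 1) (gaussianReal μ 1) α

/-- Two output distributions satisfy `μ`-GDP: their trade-off functions, in both orders
(adjacency of datasets is symmetric), dominate `G(μ)` on `[0, 1]`. -/
def IsGDP {X : Type*} [MeasurableSpace X] (μ : ℝ) (P Q : Measure X) : Prop :=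
  ∀ α ∈ Set.Icc (0 : ℝ) 1,
    gaussianTradeOff μ α ≤ tradeOff P Q α ∧ gaussianTradeOff μ α ≤ tradeOff Q P α

/-- The value `δ` associated with `ε` by a `μ`-GDP guarantee,
`Φ(-ε/μ + μ/2) - e^ε Φ(-ε/μ - μ/2)`, with `Φ` the standard normal distribution function.
At `μ = 0` the formula is read as its limit for `μ → 0⁺`, namely `max(0, 1 - e^ε)`. -/
def gdpDelta (μ ε : ℝ) : ℝ :=
  if μ = 0 then max 0 (1 - Real.exp ε)
  else cdf (gaussianReal 0 1) (-ε / μ + μ / 2)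
    - Real.exp ε * cdf (gaussianReal 0 1) (-ε / μ - μ / 2)

/-- `ε_GDP(μ, δ)`: the solution `ε ∈ ℝ` of `gdpDelta μ ε = δ` (its existence and uniqueness are
asserted wherever it is used). -/
def epsGDP (μ δ : ℝ) : ℝ := sInf {ε : ℝ | gdpDelta μ ε = δ}

/-! ### Per-instance unlearning -/

/-- `(ε, δ)`-per-instance unlearning of the `i`-th point of the dataset `D`. A randomized learning
algorithm sends a dataset to a distribution on parameters; a randomized unlearning algorithm sends
a parameter, a retain dataset and a point to forget (or none) to a distribution on parameters;
`i.removeNth D` is the dataset `D` without its `i`-th point. -/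
def IsPerInstanceUnlearning {Z Θ : Type*} [MeasurableSpace Θ]
    (𝒜 : (n : ℕ) → (Fin n → Z) → Measure Θ)
    (𝒰 : (n : ℕ) → Θ → (Fin n → Z) → Option Z → Measure Θ)
    {n : ℕ} (D : Fin (n + 1) → Z) (i : Fin (n + 1)) (ε δ : ℝ) : Prop :=
  ∀ S : Set Θ, MeasurableSet S →
    ((𝒜 (n + 1) D).bind fun θ => 𝒰 n θ (i.removeNth D) (some (D i))).real S ≤
      Real.exp ε * ((𝒜 n (i.removeNth D)).bind fun θ => 𝒰 n θ (i.removeNth D) none).real S + δ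

/-! ### Regularized empirical risk and Langevin dynamics -/

/-- The non-averaged regularized empirical risk
`f_D(θ) = ∑ⱼ ℓ(θ; xⱼ, yⱼ) + lam * r(θ)` of a dataset `D` of pairs `(xⱼ, yⱼ)`. -/
def erm {Θ X Y : Type*} (ℓ : Θ → X → Y → ℝ) (r : Θ → ℝ) (lam : ℝ) {n : ℕ}
    (D : Fin n → X × Y) (θ : Θ) : ℝ :=
  ∑ j, ℓ θ (D j).1 (D j).2 + lam * r θ

/-- The empirical risk of the dataset without its `i`-th point is the leave-one-out objective. -/
theorem erm_removeNth {Θ X Y : Type*} (ℓ : Θ → X → Y → ℝ) (r : Θ → ℝ) (lam : ℝ) {n : ℕ}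
    (D : Fin (n + 1) → X × Y) (i : Fin (n + 1)) (θ : Θ) :
    erm ℓ r lam (i.removeNth D) θ =
      ∑ j ∈ Finset.univ.erase i, ℓ θ (D j).1 (D j).2 + lam * r θ := by
  have h := Finset.add_sum_erase Finset.univ (fun j => ℓ θ (D j).1 (D j).2) (Finset.mem_univ i)
  rw [Fin.sum_univ_succAbove _ i] at h
  have h' := add_left_cancel h
  simp only [erm, Fin.removeNth]
  rw [h']

section Langevin

variable {E : Type*} [NormedAddCommGroup E] [InnerProductSpace ℝ E] [CompleteSpace E]

/-- `f` is differentiable, `m`-strongly convex and `L`-smooth. -/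
def IsStronglyConvexSmooth (f : E → ℝ) (m L : ℝ) : Prop :=
  Differentiable ℝ f ∧ StrongConvexOn Set.univ m f ∧
    ∀ θ θ' : E, ‖∇ f θ - ∇ f θ'‖ ≤ L * ‖θ - θ'‖

/-- The contraction factor `c = max(|1 - η m|, |1 - η L|)` of the gradient step `θ - η ∇f(θ)`. -/
def contractionFactor (η m L : ℝ) : ℝ := max |1 - η * m| |1 - η * L|

/-- One discrete Langevin step from `θ` with noise `z`: `θ - η ∇f(θ) + √(2 η σ²) z`. -/
def langevinStep (f : E → ℝ) (η σ : ℝ) (θ z : E) : E :=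
  θ - η • ∇ f θ + Real.sqrt (2 * η * σ ^ 2) • z

/-- The trajectory `θ_k` from the point `θ₀` that makes `T` Langevin steps on `f` with noise level
`σl`, and from then on Langevin steps on `g` with noise level `σu`; `ξ k` is the noise of the step
from `θ_k` to `θ_{k+1}`. -/
def trajectory {Ω : Type*} (f g : E → ℝ) (η σl σu : ℝ) (T : ℕ) (θ₀ : E) (ξ : ℕ → Ω → E) :
    ℕ → Ω → E
  | 0, _ => θ₀
  | k + 1, ω =>
    if k < T then langevinStep f η σl (trajectory f g η σl σu T θ₀ ξ k ω) (ξ k ω)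
    else langevinStep g η σu (trajectory f g η σl σu T θ₀ ξ k ω) (ξ k ω)

/-- The per-instance sensitivity `‖η (∇f_{D⁻ⁱ}(θ) - ∇f_D(θ))‖` at the parameter `θ`, of the
`i`-th point of the dataset `D`. -/
def sensitivity {X Y : Type*} (ℓ : E → X → Y → ℝ) (r : E → ℝ) (lam η : ℝ) {n : ℕ}
    (D : Fin (n + 1) → X × Y) (i : Fin (n + 1)) (θ : E) : ℝ :=
  ‖η • (∇ (erm ℓ r lam (i.removeNth D)) θ - ∇ (erm ℓ r lam D) θ)‖

variable [FiniteDimensional ℝ E] [MeasurableSpace E] [BorelSpace E]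

/-- The law of the Langevin iterate on `f` after `k` steps from the point `θ`, with independent
`𝒩(0, I)` noises. -/
def langevinLaw (f : E → ℝ) (η σ : ℝ) : ℕ → E → Measure E
  | 0, θ => Measure.dirac θ
  | k + 1, θ =>
    (langevinLaw f η σ k θ).bind fun θ' => (stdGaussian E).map (langevinStep f η σ θ')

/-- The learning algorithm: `T` Langevin steps on the empirical risk of the dataset, from `θ₀`. -/
def learnAlg {X Y : Type*} (ℓ : E → X → Y → ℝ) (r : E → ℝ) (lam η σl : ℝ) (T : ℕ) (θ₀ : E) :
    (n : ℕ) → (Fin n → X × Y) → Measure E :=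
  fun _ D => langevinLaw (erm ℓ r lam D) η σl T θ₀

/-- The unlearning algorithm: `K` further Langevin steps on the empirical risk of the retain
dataset. It makes no use of the point to forget. -/
def unlearnAlg {X Y : Type*} (ℓ : E → X → Y → ℝ) (r : E → ℝ) (lam η σu : ℝ) (K : ℕ) :
    (n : ℕ) → E → (Fin n → X × Y) → Option (X × Y) → Measure E :=
  fun _ θ D _ => langevinLaw (erm ℓ r lam D) η σu K θ

end Langevin

/-! ### The privacy parameter -/

def vLearn (η σl c : ℝ) (T K : ℕ) : ℝ :=
  ∑ k ∈ Finset.range (T + 1), 2 * η * σl ^ 2 * c ^ (2 * (T + K - k))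

def vUnlearn (η σu c : ℝ) (T K : ℕ) : ℝ :=
  ∑ k ∈ Finset.Icc (T + 1) (T + K), 2 * η * σu ^ 2 * c ^ (2 * (T + K - k))

/-- `μ = (∑_{k=0}^{T} c^{T+K-k} s_k) / √(V_learn + V_unlearn)`. -/
def muGDP (η σl σu c : ℝ) (T K : ℕ) (s : ℕ → ℝ) : ℝ :=
  (∑ k ∈ Finset.range (T + 1), c ^ (T + K - k) * s k) /
    Real.sqrt (vLearn η σl c T K + vUnlearn η σu c T K)

end

/-! ### Contraction of a gradient step for strongly convex smooth functions. -/

section GradientStep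

variable {E : Type*} [NormedAddCommGroup E] [InnerProductSpace ℝ E] [CompleteSpace E]

/-! The two chains are compared through the hockey-stick functional `E_A φ - t E_B φ`. Translating
the Gaussian noise of one step of the second chain by `w` multiplies the density by `e^{-s}` with
`s` of law `𝒩(‖w‖²/2, ‖w‖²)` (Cameron–Martin). These losses add up and the family is stable under
convolution, so shifts of total squared length at most `μ²` cost no more than distinguishing
`𝒩(0,1)` from `𝒩(μ,1)` (`hockeyStick_gaussianChain_le`). The shifts only have to make the two chains
meet at time `n = T + K`.

A gradient step on the retain objective contracts distances by `c` (`norm_gradientStep_sub_le`), a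
learning step widens the gap by at most the sensitivity `d j`, and a shift of length `α j` narrows
it by as much. The gap is closed at time `n` if every tail sum of `c^(n-(j+1)) (d j - α j)` is
nonpositive (`greedyGap_eq_zero`), at cost `∑ α j² / v j`, where `v j` is the noise variance of step
`j`.

It remains to choose the shifts. Cauchy–Schwarz suggests `α j` proportional to `w j v j` with `w j =
c^(n-(j+1))`, but the tail constraints must hold too, and `μ` is not the natural quantity: it pairs
step `j` with `s (j+1)` and has an extra `k = 0` term both in the numerator and in the variance.
What saves the bound is that every iterate after the first step has full support, so for `1 ≤ k ≤ T`
the almost sure bound `s k` dominates the supremum `S` of the sensitivity; only the value `a ≤ S` at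
the deterministic start is special. For the profile `a, S, …, S, 0, …, 0`, `exists_shift_allocation`
finds admissible shifts of cost at most `μ²`.

Hockey-stick bounds at all levels then give the trade-off bound (`gaussianTradeOff_le_tradeOff`),
and the level `ε_GDP` gives unlearning. -/

lemma hasDerivAt_comp_line {f : E → ℝ} {x d : E} {t : ℝ}
    (hf : DifferentiableAt ℝ f (x + t • d)) :
    HasDerivAt (fun u : ℝ => f (x + u • d)) (inner ℝ (∇ f (x + t • d)) d) t := by
  have hline : HasDerivAt (fun u : ℝ => x + u • d) d t := by
    simpa using ((hasDerivAt_id t).smul_const d).const_add x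
  have h := hf.hasGradientAt.hasFDerivAt.comp_hasDerivAt t hline
  simpa [Function.comp_def] using h

namespace IsStronglyConvexSmooth

variable {f : E → ℝ} {m L : ℝ}

lemma quadratic_lower_bound (hf : IsStronglyConvexSmooth f m L) (x y : E) :
    f x + inner ℝ (∇ f x) (y - x) + m / 2 * ‖y - x‖ ^ 2 ≤ f y := by
  have hconv := strongConvexOn_iff_convex.1 hf.2.1
  have hline : ConvexOn ℝ Set.univ
      (fun t : ℝ => f (x + t • (y - x)) - m / 2 * ‖x + t • (y - x)‖ ^ 2) := by
    have := hconv.comp_affineMap (AffineMap.lineMap x y : ℝ →ᵃ[ℝ] E)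
    simpa [Function.comp_def, AffineMap.lineMap_apply, add_comm] using this
  have hd : HasDerivAt (fun t : ℝ => f (x + t • (y - x)) - m / 2 * ‖x + t • (y - x)‖ ^ 2)
      (inner ℝ (∇ f x) (y - x) - m / 2 * (2 * inner ℝ x (y - x))) 0 := by
    have h1 := hasDerivAt_comp_line (d := y - x) (hf.1 (x + (0 : ℝ) • (y - x)))
    have hl : HasDerivAt (fun u : ℝ => x + u • (y - x)) (y - x) 0 := by
      simpa using ((hasDerivAt_id (0 : ℝ)).smul_const (y - x)).const_add x
    have h2 := (hl.norm_sq).const_mul (m / 2)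
    simpa using h1.fun_sub h2
  have hslope := hline.le_slope_of_hasDerivAt (Set.mem_univ 0) (Set.mem_univ 1) one_pos hd
  simp only [slope_def_field, sub_zero, div_one, one_smul, zero_smul, add_zero,
    add_sub_cancel] at hslope
  have hn : ‖y - x‖ ^ 2 = ‖y‖ ^ 2 - ‖x‖ ^ 2 - 2 * inner ℝ x (y - x) := by
    rw [norm_sub_sq_real, inner_sub_right, real_inner_self_eq_norm_sq, real_inner_comm y x]
    ring
  rw [hn]
  linarith

lemma quadratic_upper_bound (hf : IsStronglyConvexSmooth f m L) (x y : E) :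
    f y ≤ f x + inner ℝ (∇ f x) (y - x) + L / 2 * ‖y - x‖ ^ 2 := by
  set d := y - x with hd
  let ψ : ℝ → ℝ := fun t => f (x + t • d) - t * inner ℝ (∇ f x) d - L / 2 * ‖d‖ ^ 2 * t ^ 2
  have hψ : ∀ t, HasDerivAt ψ
      (inner ℝ (∇ f (x + t • d)) d - inner ℝ (∇ f x) d - L / 2 * ‖d‖ ^ 2 * (2 * t)) t := by
    intro t
    have h1 := hasDerivAt_comp_line (d := d) (hf.1 (x + t • d))
    have h2 := (hasDerivAt_id t).mul_const (inner ℝ (∇ f x) d)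
    have h3 := (hasDerivAt_pow 2 t).const_mul (L / 2 * ‖d‖ ^ 2)
    simpa [ψ] using (h1.fun_sub h2).fun_sub h3
  have hanti : AntitoneOn ψ (Set.Icc 0 1) := by
    refine antitoneOn_of_deriv_nonpos (convex_Icc 0 1)
      (fun t _ => (hψ t).continuousAt.continuousWithinAt)
      (fun t _ => (hψ t).differentiableAt.differentiableWithinAt) fun t ht => ?_
    rw [interior_Icc] at ht
    rw [(hψ t).deriv, ← inner_sub_left]
    have h1 := real_inner_le_norm (∇ f (x + t • d) - ∇ f x) d
    have h2 := hf.2.2 (x + t • d) x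
    rw [add_sub_cancel_left, norm_smul, Real.norm_of_nonneg ht.1.le] at h2
    have h3 := mul_le_mul_of_nonneg_right h2 (norm_nonneg d)
    nlinarith
  have h01 := hanti (Set.left_mem_Icc.2 zero_le_one) (Set.right_mem_Icc.2 zero_le_one) zero_le_one
  simp only [ψ, one_smul, zero_smul, add_zero, hd, add_sub_cancel] at h01
  rw [hd]
  linarith

lemma le_of_ne (hf : IsStronglyConvexSmooth f m L) {x y : E} (hxy : x ≠ y) : m ≤ L := by
  have h1 := hf.quadratic_lower_bound x y
  have h2 := hf.quadratic_upper_bound x y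
  have h3 : 0 < ‖y - x‖ ^ 2 := by
    have := norm_pos_iff.2 (sub_ne_zero.2 hxy.symm)
    positivity
  have h4 : m / 2 * ‖y - x‖ ^ 2 ≤ L / 2 * ‖y - x‖ ^ 2 := by linarith
  have := le_of_mul_le_mul_right h4 h3
  linarith

/-- Cocoercivity of the gradient of a strongly convex smooth function. -/
lemma inner_gradient_sub_le_zero (hf : IsStronglyConvexSmooth f m L) (x y : E) :
    inner ℝ (∇ f x - ∇ f y - m • (x - y)) (∇ f x - ∇ f y - L • (x - y)) ≤ 0 := by
  rcases eq_or_ne x y with rfl | hxy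
  · simp
  have hmL := hf.le_of_ne hxy
  set G := ∇ f x - ∇ f y - m • (x - y) with hG
  -- At `y + s • G` and at `x - s • G`, `f` is bounded below by the quadratic at the far endpoint
  -- and above by the quadratic at the near one. In the sum all values of `f` cancel; `s` is later
  -- optimised to `1 / (L - m)`.
  have key : ∀ s : ℝ, 2 * s * ‖G‖ ^ 2 - (L - m) * s ^ 2 * ‖G‖ ^ 2 ≤ inner ℝ G (x - y) := by
    intro s
    have a1 := hf.quadratic_lower_bound x (y + s • G)
    have a2 := hf.quadratic_upper_bound y (y + s • G)
    have b1 := hf.quadratic_lower_bound y (x - s • G)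
    have b2 := hf.quadratic_upper_bound x (x - s • G)
    have e4 : ∀ v : E, inner ℝ (∇ f x) v - inner ℝ (∇ f y) v
        = inner ℝ G v + m * inner ℝ (x - y) v := by
      intro v
      rw [hG, inner_sub_left, inner_sub_left, real_inner_smul_left]
      ring
    have f1 := e4 G
    have f2 := e4 (x - y)
    have e1 : y + s • G - x = s • G - (x - y) := by abel
    have e2 : x - s • G - y = (x - y) - s • G := by abel
    have e3 : x - s • G - x = -(s • G) := by abel
    have e6 : ‖s • G‖ ^ 2 = s ^ 2 * ‖G‖ ^ 2 := by rw [norm_smul, mul_pow, Real.norm_eq_abs, sq_abs]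
    rw [e1, norm_sub_sq_real, e6] at a1
    rw [add_sub_cancel_left, e6] at a2
    rw [e2, norm_sub_sq_real, e6] at b1
    rw [e3, norm_neg, e6] at b2
    generalize x - y = d at *
    rw [real_inner_self_eq_norm_sq] at f1 f2
    rw [inner_sub_right, real_inner_smul_right, real_inner_smul_left] at a1
    rw [inner_sub_right, real_inner_smul_right, real_inner_smul_right] at b1
    rw [real_inner_smul_right] at a2
    rw [inner_neg_right, real_inner_smul_right] at b2
    rw [real_inner_comm G d] at f1
    rw [real_inner_comm G d] at b1
    linear_combination a1 + a2 + b1 + b2 - 2 * s * f1 + f2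
  have hRQ : ‖G‖ ^ 2 ≤ (L - m) * inner ℝ G (x - y) := by
    rcases hmL.eq_or_lt with rfl | hlt
    · by_contra! hpos
      simp only [sub_self, zero_mul] at hpos key
      -- For `m = L` the bound is linear in `s`; this `s` makes its left side exceed the right side
      -- by `1`.
      have := key ((inner ℝ G (x - y) + 1) / (2 * ‖G‖ ^ 2))
      rw [show 2 * ((inner ℝ G (x - y) + 1) / (2 * ‖G‖ ^ 2)) * ‖G‖ ^ 2 = inner ℝ G (x - y) + 1 by
        have : ‖G‖ ≠ 0 := by rintro h0; simp [h0] at hpos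
        field_simp] at this
      linarith
    · have hM : 0 < L - m := by linarith
      have := mul_le_mul_of_nonneg_left (key (1 / (L - m))) hM.le
      have e : (L - m) * (2 * (1 / (L - m)) * ‖G‖ ^ 2 - (L - m) * (1 / (L - m)) ^ 2 * ‖G‖ ^ 2)
          = ‖G‖ ^ 2 := by
        field_simp
        ring
      rwa [e] at this
  have e5 : ∇ f x - ∇ f y - L • (x - y) = G - (L - m) • (x - y) := by
    rw [hG, sub_smul]
    abel
  rw [e5, inner_sub_right, real_inner_smul_right, real_inner_self_eq_norm_sq]
  linarith

/-- The gradient step is a contraction with factor `contractionFactor η m L`. -/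
lemma norm_gradientStep_sub_le (hf : IsStronglyConvexSmooth f m L) {η : ℝ} (hη : 0 ≤ η)
    (x y : E) :
    ‖(x - η • ∇ f x) - (y - η • ∇ f y)‖ ≤ contractionFactor η m L * ‖x - y‖ := by
  rcases eq_or_ne x y with rfl | hxy
  · simp
  have hmL := hf.le_of_ne hxy
  have hco := hf.inner_gradient_sub_le_zero x y
  set d := x - y
  set h := ∇ f x - ∇ f y
  -- Completing the square in `hco`: `h` lies in the ball with diameter from `m • d` to `L • d`.
  have hball : ‖h - ((m + L) / 2) • d‖ ≤ (L - m) / 2 * ‖d‖ := by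
    refine abs_le_of_sq_le_sq' ?_ (mul_nonneg (by linarith) (norm_nonneg d)) |>.2
    rw [norm_sub_sq_real, norm_smul, mul_pow, Real.norm_eq_abs, sq_abs, real_inner_smul_right]
    simp only [inner_sub_left, inner_sub_right, real_inner_smul_left, real_inner_smul_right,
      real_inner_self_eq_norm_sq] at hco
    rw [real_inner_comm h d] at hco
    linear_combination hco
  have e : (x - η • ∇ f x) - (y - η • ∇ f y)
      = (1 - η * ((m + L) / 2)) • d - η • (h - ((m + L) / 2) • d) := by
    simp only [d, h]
    module
  rw [e]
  refine (norm_sub_le _ _).trans ?_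
  rw [norm_smul, norm_smul, Real.norm_eq_abs, Real.norm_of_nonneg hη]
  have h1 : |1 - η * ((m + L) / 2)| + η * ((L - m) / 2) ≤ contractionFactor η m L := by
    unfold contractionFactor
    rcases abs_cases (1 - η * ((m + L) / 2)) with h | h
    · refine le_max_of_le_left (le_trans ?_ (le_abs_self _))
      linarith
    · refine le_max_of_le_right (le_trans ?_ (neg_le_abs _))
      linarith
  nlinarith [mul_le_mul_of_nonneg_left hball hη, mul_le_mul_of_nonneg_right h1 (norm_nonneg d)]

lemma continuous_gradient (hf : IsStronglyConvexSmooth f m L) : Continuous (∇ f) :=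
  (LipschitzWith.of_dist_le_mul (K := L.toNNReal) fun x y => by
    rw [dist_eq_norm, dist_eq_norm]
    exact (hf.2.2 x y).trans (mul_le_mul_of_nonneg_right (Real.le_coe_toNNReal L)
      (norm_nonneg _))).continuous

end IsStronglyConvexSmooth

lemma contractionFactor_nonneg (η m L : ℝ) : 0 ≤ contractionFactor η m L :=
  (abs_nonneg _).trans (le_max_left _ _)

lemma contractionFactor_le_one {η m L : ℝ} (hm : 0 < m) (hmL : m ≤ L) (hη : 0 < η)
    (hηL : η < 2 / L) : contractionFactor η m L ≤ 1 := by
  have hL : 0 < L := hm.trans_le hmL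
  have h1 : η * L < 2 := (lt_div_iff₀ hL).1 hηL
  have h2 : η * m ≤ η * L := mul_le_mul_of_nonneg_left hmL hη.le
  have h3 : 0 < η * m := mul_pos hη hm
  refine max_le (abs_le.2 ⟨?_, ?_⟩) (abs_le.2 ⟨?_, ?_⟩) <;> linarith

end GradientStep

/-! ### One-dimensional Gaussian computations and the hockey-stick function. -/

section GaussianReal

open Filter Topology
open scoped NNReal ENNReal

/-- Change of variables for a translation of the standard Gaussian distribution. -/
lemma lintegral_gaussianReal_translate {f : ℝ → ℝ≥0∞} (hf : Measurable f) (w : ℝ) :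
    ∫⁻ x, ENNReal.ofReal (Real.exp (-(w * x) - w ^ 2 / 2)) * f (x + w) ∂gaussianReal 0 1
      = ∫⁻ x, f x ∂gaussianReal 0 1 := by
  rw [gaussianReal_of_var_ne_zero _ one_ne_zero,
    lintegral_withDensity_eq_lintegral_mul _ (measurable_gaussianPDF 0 1) (by fun_prop),
    lintegral_withDensity_eq_lintegral_mul _ (measurable_gaussianPDF 0 1) hf]
  conv_rhs => rw [← lintegral_add_right_eq_self _ w]
  refine lintegral_congr fun x => ?_
  simp only [Pi.mul_apply]
  rw [← mul_assoc, gaussianPDF, gaussianPDF, ← ENNReal.ofReal_mul (gaussianPDFReal_nonneg _ _ _)]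
  congr 2
  simp only [gaussianPDFReal, mul_assoc, ← Real.exp_add]
  congr 2
  simp only [NNReal.coe_one]
  ring

lemma integrable_gaussianReal_translate_indicator {S : Set ℝ} (hS : MeasurableSet S) (w : ℝ) :
    Integrable (fun x => Real.exp (-(w * x) - w ^ 2 / 2) * S.indicator (fun _ => (1 : ℝ)) (x + w))
      (gaussianReal 0 1) := by
  have h1 : Integrable (fun x => Real.exp (-(w * x) - w ^ 2 / 2)) (gaussianReal 0 1) := by
    have := (integrable_exp_mul_gaussianReal (μ := 0) (v := 1) (-w)).mul_const
      (Real.exp (-(w ^ 2 / 2)))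
    simpa [← Real.exp_add, sub_eq_add_neg] using this
  refine h1.mul_bdd (c := 1) (Measurable.aestronglyMeasurable ?_) (ae_of_all _ fun x => ?_)
  · exact (measurable_const.indicator hS).comp (measurable_id.add_const w)
  · by_cases hx : x + w ∈ S <;> simp [Set.indicator, hx]

lemma integral_gaussianReal_translate_indicator {S : Set ℝ} (hS : MeasurableSet S) (w : ℝ) :
    ∫ x, Real.exp (-(w * x) - w ^ 2 / 2) * S.indicator (fun _ => (1 : ℝ)) (x + w)
      ∂gaussianReal 0 1 = (gaussianReal 0 1).real S := by
  have hm : Measurable (S.indicator fun _ => (1 : ℝ)) := measurable_const.indicator hS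
  have hn : ∀ y, 0 ≤ S.indicator (fun _ => (1 : ℝ)) y :=
    fun y => Set.indicator_nonneg (fun _ _ => zero_le_one) y
  rw [integral_eq_lintegral_of_nonneg_ae
    (ae_of_all _ fun x => mul_nonneg (Real.exp_pos _).le (hn _))
    (Measurable.aestronglyMeasurable (by fun_prop))]
  simp_rw [ENNReal.ofReal_mul (Real.exp_pos _).le]
  rw [lintegral_gaussianReal_translate (f := fun y =>
      ENNReal.ofReal (S.indicator (fun _ => (1 : ℝ)) y)) (by fun_prop) w,
    ← integral_eq_lintegral_of_nonneg_ae (ae_of_all _ hn) hm.aestronglyMeasurable]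
  exact integral_indicator_one hS

lemma gaussianReal_real_Ici (a : ℝ) :
    (gaussianReal 0 1).real (Set.Ici a) = cdf (gaussianReal 0 1) (-a) := by
  have h : (gaussianReal 0 1).map (fun x => -x) = gaussianReal 0 1 := by
    simpa using gaussianReal_map_neg (μ := 0) (v := 1)
  rw [cdf_eq_real]
  conv_rhs => rw [← h]
  rw [map_measureReal_apply measurable_neg measurableSet_Iic]
  congr 1
  ext x
  simp

lemma gaussianReal_real_Ioi (a : ℝ) :
    (gaussianReal 0 1).real (Set.Ioi a) = cdf (gaussianReal 0 1) (-a) := by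
  have := nullSingletonClass_gaussianReal (μ := 0) (v := 1) one_ne_zero
  rw [← gaussianReal_real_Ici]
  exact measureReal_congr Ioi_ae_eq_Ici

lemma continuous_cdf_gaussianReal : Continuous (cdf (gaussianReal 0 1)) := by
  have := nullSingletonClass_gaussianReal (μ := 0) (v := 1) one_ne_zero
  refine continuous_iff_continuousAt.2 fun x => ?_
  rw [(monotone_cdf _).continuousAt_iff_leftLim_eq_rightLim, StieltjesFunction.rightLim_eq]
  refine le_antisymm ((monotone_cdf _).leftLim_le le_rfl) ?_
  have h := (cdf (gaussianReal 0 1)).measure_singleton x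
  rw [measure_cdf, measure_singleton, eq_comm, ENNReal.ofReal_eq_zero] at h
  linarith

/-- `E_P (1 - t Q/P)₊` for two Gaussian distributions whose log-likelihood ratio has variance `v`:
the largest value of `E_P φ - t E_Q φ` over the tests `φ`. -/
noncomputable def gaussianHockeyStick (v : ℝ≥0) (t : ℝ) : ℝ :=
  ∫ s, max 0 (1 - t * Real.exp (-s)) ∂gaussianReal (v / 2) v

lemma max_zero_one_sub_mem_Icc {r : ℝ} (hr : 0 ≤ r) : max 0 (1 - r) ∈ Set.Icc (0 : ℝ) 1 :=
  ⟨le_max_left _ _, max_le zero_le_one (by linarith)⟩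

lemma integrable_of_mem_Icc {X : Type*} [MeasurableSpace X] {P : Measure X} [IsFiniteMeasure P]
    {f : X → ℝ} (hf : Measurable f) (h : ∀ x, f x ∈ Set.Icc (0 : ℝ) 1) : Integrable f P :=
  Integrable.of_bound hf.aestronglyMeasurable 1 (ae_of_all _ fun x => by
    rw [Real.norm_of_nonneg (h x).1]; exact (h x).2)

lemma integral_mem_Icc {X : Type*} [MeasurableSpace X] {P : Measure X} [IsProbabilityMeasure P]
    {f : X → ℝ} (hf : Measurable f) (h : ∀ x, f x ∈ Set.Icc (0 : ℝ) 1) :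
    ∫ x, f x ∂P ∈ Set.Icc (0 : ℝ) 1 := by
  refine ⟨integral_nonneg fun x => (h x).1, ?_⟩
  simpa using integral_mono (integrable_of_mem_Icc hf h) (integrable_const (μ := P) (1 : ℝ))
    fun x => (h x).2

lemma measurable_hockeyStick_integrand (t : ℝ) :
    Measurable fun s : ℝ => max 0 (1 - t * Real.exp (-s)) := by fun_prop

lemma hockeyStick_integrand_mem {t : ℝ} (ht : 0 ≤ t) (s : ℝ) :
    max 0 (1 - t * Real.exp (-s)) ∈ Set.Icc (0 : ℝ) 1 :=
  max_zero_one_sub_mem_Icc (by positivity)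

lemma gaussianHockeyStick_mem {t : ℝ} (v : ℝ≥0) (ht : 0 ≤ t) :
    gaussianHockeyStick v t ∈ Set.Icc (0 : ℝ) 1 :=
  integral_mem_Icc (measurable_hockeyStick_integrand t) (hockeyStick_integrand_mem ht)

lemma gaussianHockeyStick_zero (t : ℝ) : gaussianHockeyStick 0 t = max 0 (1 - t) := by
  simp [gaussianHockeyStick]

lemma measurable_gaussianHockeyStick (v : ℝ≥0) : Measurable (gaussianHockeyStick v) := by
  have : StronglyMeasurable (Function.uncurry fun t s : ℝ => max 0 (1 - t * Real.exp (-s))) := by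
    refine Measurable.stronglyMeasurable ?_
    unfold Function.uncurry
    fun_prop
  exact (StronglyMeasurable.integral_prod_right (ν := gaussianReal (v / 2) v) this).measurable

/-- Composition rule: the laws `𝒩(v/2, v)` form a convolution semigroup, so independent losses add
their variances. This is what makes the costs of successive steps additive. -/
lemma integral_gaussianHockeyStick (v v' : ℝ≥0) {t : ℝ} (ht : 0 ≤ t) :
    ∫ s, gaussianHockeyStick v' (t * Real.exp (-s)) ∂gaussianReal (v / 2) v
      = gaussianHockeyStick (v + v') t := by
  have hc : gaussianReal ((v + v' : ℝ≥0) / 2) (v + v')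
      = (gaussianReal (v / 2) v) ∗ (gaussianReal (v' / 2) v') := by
    rw [gaussianReal_conv_gaussianReal]
    congr 1
    push_cast
    ring
  rw [gaussianHockeyStick, hc, integral_conv
    (integrable_of_mem_Icc (measurable_hockeyStick_integrand t) (hockeyStick_integrand_mem ht))]
  refine integral_congr_ae (ae_of_all _ fun s => ?_)
  simp only [gaussianHockeyStick]
  refine integral_congr_ae (ae_of_all _ fun s' => ?_)
  simp only [neg_add, Real.exp_add]
  ring_nf

lemma integral_exp_neg_gaussianReal (v : ℝ≥0) :
    ∫ s, Real.exp (-s) ∂gaussianReal (v / 2) v = 1 := by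
  have h := congrFun (mgf_id_gaussianReal (μ := v / 2) (v := v)) (-1)
  simp only [mgf, id] at h
  convert h using 1
  · simp
  · rw [eq_comm, Real.exp_eq_one_iff]
    ring

lemma integrable_exp_neg_gaussianReal (v : ℝ≥0) :
    Integrable (fun s => Real.exp (-s)) (gaussianReal (v / 2) v) := by
  simpa using integrable_exp_mul_gaussianReal (μ := v / 2) (v := v) (-1)

/-- Jensen: an additional independent loss `s'` has `E e^{-s'} = 1`, and `r ↦ max 0 (1 - r)` is
convex. -/
lemma gaussianHockeyStick_mono {v v' : ℝ≥0} (h : v ≤ v') {t : ℝ} (ht : 0 ≤ t) :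
    gaussianHockeyStick v t ≤ gaussianHockeyStick v' t := by
  obtain ⟨d, rfl⟩ := exists_add_of_le h
  rw [← integral_gaussianHockeyStick v d ht]
  refine integral_mono
    (integrable_of_mem_Icc (measurable_hockeyStick_integrand t) (hockeyStick_integrand_mem ht))
    (integrable_of_mem_Icc ((measurable_gaussianHockeyStick d).comp (by fun_prop))
      fun s => gaussianHockeyStick_mem d (by positivity)) fun s => ?_
  refine max_le (gaussianHockeyStick_mem d (by positivity)).1 ?_
  have hi := (integrable_exp_neg_gaussianReal d).const_mul (t * Real.exp (-s))
  calc 1 - t * Real.exp (-s)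
      = ∫ s', (1 - t * Real.exp (-s) * Real.exp (-s')) ∂gaussianReal (d / 2) d := by
        rw [integral_sub (integrable_const _) hi, integral_const_mul,
          integral_exp_neg_gaussianReal]
        simp
    _ ≤ _ := integral_mono ((integrable_const _).sub hi)
        (integrable_of_mem_Icc (measurable_hockeyStick_integrand _)
          (hockeyStick_integrand_mem (by positivity))) fun s' => le_max_right _ _

lemma gaussianHockeyStick_anti (v : ℝ≥0) {t t' : ℝ} (ht : 0 ≤ t) (h : t ≤ t') :
    gaussianHockeyStick v t' ≤ gaussianHockeyStick v t := by
  refine integral_mono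
    (integrable_of_mem_Icc (measurable_hockeyStick_integrand _)
      (hockeyStick_integrand_mem (ht.trans h)))
    (integrable_of_mem_Icc (measurable_hockeyStick_integrand _)
      (hockeyStick_integrand_mem ht)) fun s => ?_
  exact max_le_max le_rfl (by gcongr)

lemma gaussianHockeyStick_convex (v : ℝ≥0) {t t' a b : ℝ} (ht : 0 ≤ t) (ht' : 0 ≤ t')
    (ha : 0 ≤ a) (hb : 0 ≤ b) (hab : a + b = 1) :
    gaussianHockeyStick v (a * t + b * t')
      ≤ a * gaussianHockeyStick v t + b * gaussianHockeyStick v t' := by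
  have h1 : ∀ r : ℝ, 0 ≤ r → Integrable (fun s : ℝ => max 0 (1 - r * Real.exp (-s)))
      (gaussianReal (v / 2) v) := fun r hr =>
    integrable_of_mem_Icc (measurable_hockeyStick_integrand r) (hockeyStick_integrand_mem hr)
  simp only [gaussianHockeyStick]
  rw [← integral_const_mul, ← integral_const_mul,
    ← integral_add ((h1 t ht).const_mul a) ((h1 t' ht').const_mul b)]
  refine integral_mono (h1 _ (by positivity)) (((h1 t ht).const_mul a).add
    ((h1 t' ht').const_mul b)) fun s => max_le ?_ ?_
  · positivity
  · have e1 := mul_le_mul_of_nonneg_left (le_max_right 0 (1 - t * Real.exp (-s))) ha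
    have e2 := mul_le_mul_of_nonneg_left (le_max_right 0 (1 - t' * Real.exp (-s))) hb
    calc 1 - (a * t + b * t') * Real.exp (-s)
        = a * (1 - t * Real.exp (-s)) + b * (1 - t' * Real.exp (-s)) := by
          linear_combination (-1 : ℝ) * hab
      _ ≤ _ := add_le_add e1 e2

/-- In the standardised variable the integrand is positive exactly above `a = ε / μ - μ / 2`. Its
exponential part is a translation density, so both parts are Gaussian tails. -/
lemma gaussianHockeyStick_eq_gdpDelta {μ : ℝ} (hμ : 0 ≤ μ) {v : ℝ≥0} (hv : (v : ℝ) = μ ^ 2)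
    (ε : ℝ) : gaussianHockeyStick v (Real.exp ε) = gdpDelta μ ε := by
  rcases hμ.eq_or_lt with rfl | hpos
  · have : v = 0 := by
      rw [← NNReal.coe_eq_zero, hv]
      simp
    rw [this, gaussianHockeyStick_zero, gdpDelta, if_pos rfl]
  set a := ε / μ - μ / 2 with ha
  have hmap : (gaussianReal 0 1).map (fun x => μ * x + μ ^ 2 / 2) = gaussianReal (v / 2) v := by
    have h1 := gaussianReal_map_const_mul (μ := 0) (v := 1) μ
    have h2 := gaussianReal_map_add_const (μ := μ * 0) (v := .mk (μ ^ 2) (sq_nonneg _) * 1)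
      (μ ^ 2 / 2)
    rw [← h1, Measure.map_map (by fun_prop) (by fun_prop)] at h2
    have h3 : NNReal.mk (μ ^ 2) (sq_nonneg _) * 1 = v := by
      rw [mul_one]
      exact NNReal.eq hv.symm
    rw [h3] at h2
    rw [hv]
    simpa [Function.comp_def] using h2
  have hμε : μ * a = ε - μ ^ 2 / 2 := by
    rw [ha]
    field_simp
  have hind : ∀ x : ℝ, max 0 (1 - Real.exp ε * Real.exp (-(μ * x + μ ^ 2 / 2)))
      = (Set.Ioi a).indicator (fun _ => (1 : ℝ)) x
        - Real.exp ε * (Real.exp (-(μ * x) - μ ^ 2 / 2)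
          * (Set.Ioi (a + μ)).indicator (fun _ => (1 : ℝ)) (x + μ)) := by
    intro x
    rw [neg_add', ← Real.exp_add]
    by_cases hx : x ∈ Set.Ioi a
    · rw [Set.indicator_of_mem hx, Set.indicator_of_mem (by simpa using hx), mul_one,
        ← Real.exp_add, max_eq_right]
      rw [sub_nonneg, Real.exp_le_one_iff]
      have := mul_lt_mul_of_pos_left (Set.mem_Ioi.1 hx) hpos
      linarith
    · rw [Set.indicator_of_notMem hx, Set.indicator_of_notMem (by simpa using hx)]
      simp only [mul_zero, sub_zero]
      refine max_eq_left ?_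
      rw [sub_nonpos, Real.one_le_exp_iff]
      have := mul_le_mul_of_nonneg_left (not_lt.1 (mt Set.mem_Ioi.2 hx)) hμ
      linarith
  have hshift := integral_gaussianReal_translate_indicator (measurableSet_Ioi (a := a + μ)) μ
  rw [gaussianHockeyStick, ← hmap, integral_map (by fun_prop)
    (measurable_hockeyStick_integrand _).aestronglyMeasurable]
  simp_rw [hind]
  have hint := integrable_gaussianReal_translate_indicator (measurableSet_Ioi (a := a + μ)) μ
  have hint' : Integrable (fun x => (Set.Ioi a).indicator (fun _ => (1 : ℝ)) x)
      (gaussianReal 0 1) := (integrable_const 1).indicator measurableSet_Ioi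
  rw [integral_sub hint' (hint.const_mul _), integral_const_mul, hshift,
    gdpDelta, if_neg hpos.ne', gaussianReal_real_Ioi]
  have h1 : ∫ x, (Set.Ioi a).indicator (fun _ => (1 : ℝ)) x ∂gaussianReal 0 1
      = (gaussianReal 0 1).real (Set.Ioi a) := integral_indicator_one measurableSet_Ioi
  rw [h1, gaussianReal_real_Ioi, ha]
  ring_nf

end GaussianReal

/-! ### The curve `ε ↦ δ(ε)` and its duality with trade-off functions. -/

section TradeOff

open Filter Topology
open scoped NNReal ENNReal

lemma gdpDelta_le_cdf {μ : ℝ} (hμ : 0 < μ) (ε : ℝ) :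
    gdpDelta μ ε ≤ cdf (gaussianReal 0 1) (-ε / μ + μ / 2) := by
  rw [gdpDelta, if_neg hμ.ne']
  have := mul_nonneg (Real.exp_pos ε).le (cdf_nonneg (gaussianReal 0 1) (-ε / μ - μ / 2))
  linarith

lemma gdpDelta_nonneg {μ : ℝ} (hμ : 0 ≤ μ) (ε : ℝ) : 0 ≤ gdpDelta μ ε := by
  rw [← gaussianHockeyStick_eq_gdpDelta hμ (v := NNReal.mk (μ ^ 2) (sq_nonneg μ)) rfl]
  exact (gaussianHockeyStick_mem _ (Real.exp_pos ε).le).1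

lemma tendsto_gdpDelta_atTop {μ : ℝ} (hμ : 0 ≤ μ) : Tendsto (gdpDelta μ) atTop (𝓝 0) := by
  rcases hμ.eq_or_lt with rfl | hpos
  · refine tendsto_const_nhds.congr' ?_
    filter_upwards [eventually_ge_atTop 0] with ε hε
    rw [gdpDelta, if_pos rfl, max_eq_left]
    linarith [Real.one_le_exp hε]
  · refine squeeze_zero (gdpDelta_nonneg hμ) (gdpDelta_le_cdf hpos) ?_
    refine (tendsto_cdf_atBot _).comp ?_
    exact tendsto_atBot_add_const_right _ _
      ((tendsto_neg_atTop_atBot).atBot_div_const hpos)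

lemma tendsto_gdpDelta_atBot {μ : ℝ} (hμ : 0 ≤ μ) : Tendsto (gdpDelta μ) atBot (𝓝 1) := by
  rcases hμ.eq_or_lt with rfl | hpos
  · have h : Tendsto (fun ε : ℝ => max 0 (1 - Real.exp ε)) atBot (𝓝 (max 0 (1 - 0))) :=
      tendsto_const_nhds.max (tendsto_const_nhds.sub Real.tendsto_exp_atBot)
    have h3 : gdpDelta 0 = fun ε => max 0 (1 - Real.exp ε) := by
      ext ε
      rw [gdpDelta, if_pos rfl]
    rw [h3]
    simpa using h
  · have h1 : Tendsto (fun ε : ℝ => cdf (gaussianReal 0 1) (-ε / μ + μ / 2)) atBot (𝓝 1) :=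
      (tendsto_cdf_atTop _).comp (tendsto_atTop_add_const_right _ _
        ((tendsto_neg_atBot_atTop).atTop_div_const hpos))
    have h2 : Tendsto (fun ε : ℝ => Real.exp ε * cdf (gaussianReal 0 1) (-ε / μ - μ / 2)) atBot
        (𝓝 0) := by
      refine squeeze_zero (fun ε => mul_nonneg (Real.exp_pos ε).le (cdf_nonneg _ _))
        (fun ε => ?_) Real.tendsto_exp_atBot
      exact mul_le_of_le_one_right (Real.exp_pos ε).le (cdf_le_one _ _)
    have h3 : gdpDelta μ = fun ε => cdf (gaussianReal 0 1) (-ε / μ + μ / 2)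
        - Real.exp ε * cdf (gaussianReal 0 1) (-ε / μ - μ / 2) := by
      ext ε
      rw [gdpDelta, if_neg hpos.ne']
    rw [h3]
    simpa using h1.sub h2

lemma continuous_gdpDelta (μ : ℝ) : Continuous (gdpDelta μ) := by
  have hc := continuous_cdf_gaussianReal
  unfold gdpDelta
  split_ifs <;> fun_prop

lemma gdpDelta_antitone {μ : ℝ} (hμ : 0 ≤ μ) : Antitone (gdpDelta μ) := by
  intro ε ε' h
  rw [← gaussianHockeyStick_eq_gdpDelta hμ (v := NNReal.mk (μ ^ 2) (sq_nonneg μ)) rfl,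
    ← gaussianHockeyStick_eq_gdpDelta hμ (v := NNReal.mk (μ ^ 2) (sq_nonneg μ)) rfl]
  exact gaussianHockeyStick_anti _ (Real.exp_pos ε).le (Real.exp_le_exp.2 h)

/-- `ε ↦ gdpDelta μ ε` is strictly decreasing where it is positive: as a function of `e^ε` it is
convex and tends to `0`. -/
lemma gdpDelta_lt_of_lt {μ : ℝ} (hμ : 0 ≤ μ) {ε ε' : ℝ} (h : ε < ε') (hpos : 0 < gdpDelta μ ε) :
    gdpDelta μ ε' < gdpDelta μ ε := by
  by_contra! hle
  have heq := le_antisymm (gdpDelta_antitone hμ h.le) hle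
  have hge : ∀ᶠ ε'' in atTop, gdpDelta μ ε ≤ gdpDelta μ ε'' := by
    filter_upwards [eventually_gt_atTop ε'] with ε'' h''
    have l1 := Real.exp_lt_exp.2 h
    have l2 := Real.exp_lt_exp.2 h''
    have hd : 0 < Real.exp ε'' - Real.exp ε := by linarith
    -- `b` writes `e^{ε'}` as a convex combination of `e^ε` and `e^{ε''}`. By convexity, equal
    -- values at `ε` and `ε'` keep the function from dropping below that value later, against the
    -- limit `0`.
    set b := (Real.exp ε' - Real.exp ε) / (Real.exp ε'' - Real.exp ε) with hb
    have hb0 : 0 < b := div_pos (by linarith) hd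
    have hb1 : b ≤ 1 := (div_le_one hd).2 (by linarith)
    have hconv := gaussianHockeyStick_convex (NNReal.mk (μ ^ 2) (sq_nonneg μ)) (Real.exp_pos ε).le
      (Real.exp_pos ε'').le (sub_nonneg.2 hb1) hb0.le (by ring)
    have hpt : (1 - b) * Real.exp ε + b * Real.exp ε'' = Real.exp ε' := by
      have : b * (Real.exp ε'' - Real.exp ε) = Real.exp ε' - Real.exp ε :=
        div_mul_cancel₀ _ hd.ne'
      linarith
    rw [hpt, gaussianHockeyStick_eq_gdpDelta hμ rfl, gaussianHockeyStick_eq_gdpDelta hμ rfl,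
      gaussianHockeyStick_eq_gdpDelta hμ rfl, heq] at hconv
    have : b * gdpDelta μ ε ≤ b * gdpDelta μ ε'' := by linarith
    exact le_of_mul_le_mul_left this hb0
  exact absurd (ge_of_tendsto (tendsto_gdpDelta_atTop hμ) hge) (not_le.2 hpos)

lemma existsUnique_gdpDelta_eq {μ δ : ℝ} (hμ : 0 ≤ μ) (hδ : δ ∈ Set.Ioo (0 : ℝ) 1) :
    ∃! ε, gdpDelta μ ε = δ := by
  obtain ⟨a, ha⟩ := ((tendsto_gdpDelta_atTop hμ).eventually (gt_mem_nhds hδ.1)).exists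
  obtain ⟨b, hb⟩ := ((tendsto_gdpDelta_atBot hμ).eventually (lt_mem_nhds hδ.2)).exists
  obtain ⟨ε, hε⟩ := mem_range_of_exists_le_of_exists_ge (continuous_gdpDelta μ) ⟨a, ha.le⟩
    ⟨b, hb.le⟩
  refine ⟨ε, hε, fun ε' hε' => ?_⟩
  rcases lt_trichotomy ε' ε with h | h | h
  · exact absurd (gdpDelta_lt_of_lt hμ h (hε'.symm ▸ hδ.1)) (by rw [hε, hε']; exact lt_irrefl _)
  · exact h
  · exact absurd (gdpDelta_lt_of_lt hμ h (hε.symm ▸ hδ.1)) (by rw [hε, hε']; exact lt_irrefl _)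

lemma gdpDelta_epsGDP {μ δ : ℝ} (hμ : 0 ≤ μ) (hδ : δ ∈ Set.Ioo (0 : ℝ) 1) :
    gdpDelta μ (epsGDP μ δ) = δ := by
  obtain ⟨ε, hε, huniq⟩ := existsUnique_gdpDelta_eq hμ hδ
  have : {ε' : ℝ | gdpDelta μ ε' = δ} = {ε} := by
    ext ε'
    exact ⟨fun h => huniq ε' h, fun h => by rw [Set.mem_singleton_iff.1 h]; exact hε⟩
  rw [epsGDP, this, csInf_singleton]
  exact hε

lemma IsTest.mem_Icc {X : Type*} [MeasurableSpace X] {φ : X → ℝ} (h : IsTest φ) (x : X) :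
    φ x ∈ Set.Icc (0 : ℝ) 1 := h.2 x

lemma IsTest.integrable {X : Type*} [MeasurableSpace X] {φ : X → ℝ} (h : IsTest φ)
    (P : Measure X) [IsFiniteMeasure P] : Integrable φ P :=
  integrable_of_mem_Icc h.1 h.mem_Icc

lemma isTest_const {X : Type*} [MeasurableSpace X] {a : ℝ} (ha : a ∈ Set.Icc (0 : ℝ) 1) :
    IsTest fun _ : X => a := ⟨measurable_const, fun _ => ha⟩

lemma isTest_indicator {X : Type*} [MeasurableSpace X] {S : Set X} (hS : MeasurableSet S) :
    IsTest (S.indicator fun _ => (1 : ℝ)) :=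
  ⟨measurable_const.indicator hS, fun _ =>
    ⟨Set.indicator_nonneg (fun _ _ => zero_le_one) _, Set.indicator_le_self' (by simp) _⟩⟩

lemma tradeOff_le {X : Type*} [MeasurableSpace X] {P Q : Measure X} {α : ℝ} {φ : X → ℝ}
    (hφ : IsTest φ) (h : ∫ x, φ x ∂P ≤ α) : tradeOff P Q α ≤ ∫ x, (1 - φ x) ∂Q := by
  refine csInf_le ⟨0, ?_⟩ ⟨φ, hφ, h, rfl⟩
  rintro _ ⟨ψ, hψ, -, rfl⟩
  exact integral_nonneg fun x => sub_nonneg.2 (hψ.2 x).2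

lemma le_tradeOff {X : Type*} [MeasurableSpace X] {P Q : Measure X} {α b : ℝ} (hα : 0 ≤ α)
    (h : ∀ φ : X → ℝ, IsTest φ → ∫ x, φ x ∂P ≤ α → b ≤ ∫ x, (1 - φ x) ∂Q) :
    b ≤ tradeOff P Q α := by
  refine le_csInf ⟨_, fun _ => 0, isTest_const (by simp), by simpa using hα, rfl⟩ ?_
  rintro _ ⟨φ, hφ, hle, rfl⟩
  exact h φ hφ hle

lemma integral_one_sub_isTest {X : Type*} [MeasurableSpace X] {Q : Measure X}
    [IsProbabilityMeasure Q] {φ : X → ℝ} (hφ : IsTest φ) :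
    ∫ x, (1 - φ x) ∂Q = 1 - ∫ x, φ x ∂Q := by
  rw [integral_sub (integrable_const _) (hφ.integrable Q)]
  simp

/-- The half-line test of level `Φ(-q)`. -/
lemma gaussianTradeOff_cdf_le (μ q : ℝ) :
    gaussianTradeOff μ (cdf (gaussianReal 0 1) (-q)) ≤ 1 - cdf (gaussianReal 0 1) (μ - q) := by
  have hT := isTest_indicator (measurableSet_Ici (a := q))
  have h1 : ∀ Q : Measure ℝ, ∫ x, (Set.Ici q).indicator (fun _ => (1 : ℝ)) x ∂Q
      = Q.real (Set.Ici q) := fun Q => integral_indicator_one measurableSet_Ici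
  refine (tradeOff_le hT (by rw [h1, gaussianReal_real_Ici])).trans ?_
  rw [integral_one_sub_isTest hT, h1]
  have h2 : (gaussianReal 0 1).map (fun x => x + μ) = gaussianReal μ 1 := by
    simpa using gaussianReal_map_add_const (μ := 0) (v := 1) μ
  rw [← h2, map_measureReal_apply (by fun_prop) measurableSet_Ici]
  have h3 : (fun x => x + μ) ⁻¹' Set.Ici q = Set.Ici (q - μ) := by
    ext x
    simp
  rw [h3, gaussianReal_real_Ici, neg_sub]

/-- Hockey-stick bounds at every level dominate the Gaussian trade-off function. -/
lemma gaussianTradeOff_le_tradeOff {X : Type*} [MeasurableSpace X] {P Q : Measure X}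
    [IsProbabilityMeasure P] [IsProbabilityMeasure Q] {μ : ℝ} (hμ : 0 ≤ μ)
    (h : ∀ φ : X → ℝ, IsTest φ → ∀ ε : ℝ,
      ∫ x, φ x ∂Q ≤ Real.exp ε * ∫ x, φ x ∂P + gdpDelta μ ε)
    {α : ℝ} (hα : α ∈ Set.Icc (0 : ℝ) 1) : gaussianTradeOff μ α ≤ tradeOff P Q α := by
  refine le_tradeOff hα.1 fun φ hφ hle => ?_
  rw [integral_one_sub_isTest hφ]
  have hQ1 := (integral_mem_Icc (P := Q) hφ.1 hφ.mem_Icc).2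
  rcases hμ.eq_or_lt with rfl | hpos
  · have h0 := h φ hφ 0
    simp only [Real.exp_zero, one_mul, gdpDelta, if_true, sub_self, max_self, add_zero] at h0
    have hc : gaussianTradeOff 0 α ≤ ∫ _, (1 - α) ∂gaussianReal 0 1 :=
      tradeOff_le (isTest_const hα) (by simp)
    simp only [integral_const, probReal_univ, one_smul] at hc
    linarith
  have hq : ∀ q : ℝ, ∫ x, φ x ∂P ≤ cdf (gaussianReal 0 1) (-q) →
      ∫ x, φ x ∂Q ≤ cdf (gaussianReal 0 1) (μ - q) := by
    intro q hq
    -- Neyman–Pearson choice: `e^{μq - μ²/2}` is the likelihood ratio of `𝒩(μ, 1)` to `𝒩(0, 1)` at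
    -- `q`, so the optimal Gaussian test has threshold `q`.
    have h1 := h φ hφ (μ * q - μ ^ 2 / 2)
    rw [gdpDelta, if_neg hpos.ne',
      show -(μ * q - μ ^ 2 / 2) / μ + μ / 2 = μ - q by field_simp; ring,
      show -(μ * q - μ ^ 2 / 2) / μ - μ / 2 = -q by field_simp; ring] at h1
    have := mul_le_mul_of_nonneg_left hq (Real.exp_pos (μ * q - μ ^ 2 / 2)).le
    linarith
  -- The levels `0` and `1` are treated apart, since only levels strictly between them are written
  -- below as `Φ(-q)` with finite `q`; for `0`, let `q → ∞`.
  rcases hα.1.eq_or_lt with rfl | hα0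
  · have hlim : Tendsto (fun q => cdf (gaussianReal 0 1) (μ - q)) atTop (𝓝 0) :=
      (tendsto_cdf_atBot _).comp (tendsto_atBot_add_const_left _ μ tendsto_neg_atTop_atBot)
    have hQ0 : ∫ x, φ x ∂Q ≤ 0 :=
      ge_of_tendsto' hlim fun q => hq q (hle.trans (cdf_nonneg _ _))
    have hc : gaussianTradeOff μ 0 ≤ ∫ _, (1 - 0) ∂gaussianReal μ 1 :=
      tradeOff_le (isTest_const (by simp)) (by simp)
    simp only [integral_const, probReal_univ, one_smul] at hc
    linarith
  rcases hα.2.eq_or_lt with rfl | hα1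
  · have hc : gaussianTradeOff μ 1 ≤ ∫ _, (1 - 1) ∂gaussianReal μ 1 :=
      tradeOff_le (isTest_const (by simp)) (by simp)
    simp only [sub_self, integral_zero] at hc
    linarith
  obtain ⟨a, ha⟩ := ((tendsto_cdf_atBot (gaussianReal 0 1)).eventually (gt_mem_nhds hα0)).exists
  obtain ⟨b, hb⟩ := ((tendsto_cdf_atTop (gaussianReal 0 1)).eventually (lt_mem_nhds hα1)).exists
  obtain ⟨q, rfl⟩ := mem_range_of_exists_le_of_exists_ge continuous_cdf_gaussianReal ⟨a, ha.le⟩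
    ⟨b, hb.le⟩
  have hG := gaussianTradeOff_cdf_le μ (-q)
  rw [neg_neg] at hG
  have := hq (-q) (by rwa [neg_neg])
  linarith

end TradeOff

/-! ### Cameron–Martin formula and full support of the standard Gaussian. -/

section StdGaussian

open scoped NNReal ENNReal

variable {ι : Type*} [Fintype ι]

lemma map_withDensity_pi_gaussianReal (w : ι → ℝ) :
    ((Measure.pi fun _ : ι => gaussianReal 0 1).withDensity fun x =>
      ENNReal.ofReal (∏ i, Real.exp (-(w i * x i) - w i ^ 2 / 2))).map (fun x => x + w)
      = Measure.pi fun _ : ι => gaussianReal 0 1 := by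
  refine (Measure.pi_eq fun S hS => ?_).symm
  have hpi : MeasurableSet ((fun x : ι → ℝ => x + w) ⁻¹' Set.univ.pi S) :=
    (measurable_id.add_const w) (MeasurableSet.univ_pi hS)
  rw [Measure.map_apply (by fun_prop) (MeasurableSet.univ_pi hS), withDensity_apply _ hpi,
    ← lintegral_indicator hpi]
  have hprod : ∀ x : ι → ℝ, ((fun x : ι → ℝ => x + w) ⁻¹' Set.univ.pi S).indicator
      (fun x => ENNReal.ofReal (∏ i, Real.exp (-(w i * x i) - w i ^ 2 / 2))) x
      = ENNReal.ofReal (∏ i, (Real.exp (-(w i * x i) - w i ^ 2 / 2)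
        * (S i).indicator (fun _ => (1 : ℝ)) (x i + w i))) := by
    intro x
    by_cases hx : ∀ i, x i + w i ∈ S i
    · rw [Set.indicator_of_mem (by simpa using hx)]
      simp [hx]
    · rw [Set.indicator_of_notMem (by simpa using hx)]
      push Not at hx
      obtain ⟨i, hi⟩ := hx
      rw [Finset.prod_eq_zero (Finset.mem_univ i) (by simp [hi]), ENNReal.ofReal_zero]
  simp_rw [hprod]
  rw [← ofReal_integral_eq_lintegral_ofReal
    (Integrable.fintype_prod fun i => integrable_gaussianReal_translate_indicator (hS i) (w i))
    (ae_of_all _ fun x => Finset.prod_nonneg fun i _ => mul_nonneg (Real.exp_pos _).le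
      (Set.indicator_nonneg (fun _ _ => zero_le_one) _)),
    integral_fintype_prod_eq_prod (f := fun i x => Real.exp (-(w i * x) - w i ^ 2 / 2)
        * (S i).indicator (fun _ => (1 : ℝ)) (x + w i)),
    ENNReal.ofReal_prod_of_nonneg fun i _ => integral_nonneg fun x =>
      mul_nonneg (Real.exp_pos _).le (Set.indicator_nonneg (fun _ _ => zero_le_one) _)]
  refine Finset.prod_congr rfl fun i _ => ?_
  rw [integral_gaussianReal_translate_indicator (hS i), ofReal_measureReal]

/-- The Cameron–Martin formula for the standard Gaussian distribution. -/
lemma lintegral_stdGaussian_translate {f : EuclideanSpace ℝ ι → ℝ≥0∞} (hf : Measurable f)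
    (w : EuclideanSpace ℝ ι) :
    ∫⁻ x, ENNReal.ofReal (Real.exp (-(inner ℝ w x + ‖w‖ ^ 2 / 2))) * f (x + w)
      ∂stdGaussian (EuclideanSpace ℝ ι) = ∫⁻ x, f x ∂stdGaussian (EuclideanSpace ℝ ι) := by
  rw [← map_pi_eq_stdGaussian, lintegral_map (by fun_prop) (by fun_prop),
    lintegral_map hf (by fun_prop)]
  conv_rhs => rw [← map_withDensity_pi_gaussianReal w.ofLp]
  rw [lintegral_map (by fun_prop) (by fun_prop), lintegral_withDensity_eq_lintegral_mul _
    (by fun_prop) (by fun_prop)]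
  refine lintegral_congr fun x => ?_
  simp only [Pi.mul_apply, ← Real.exp_sum]
  congr 3
  rw [EuclideanSpace.real_norm_sq_eq, PiLp.inner_apply, Finset.sum_div, ← Finset.sum_add_distrib,
    ← Finset.sum_neg_distrib]
  refine Finset.sum_congr rfl fun i _ => ?_
  simp
  ring

lemma integral_stdGaussian_translate {f : EuclideanSpace ℝ ι → ℝ} (hf : Measurable f)
    (hf0 : ∀ x, 0 ≤ f x) (w : EuclideanSpace ℝ ι) :
    ∫ x, Real.exp (-(inner ℝ w x + ‖w‖ ^ 2 / 2)) * f (x + w)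
      ∂stdGaussian (EuclideanSpace ℝ ι) = ∫ x, f x ∂stdGaussian (EuclideanSpace ℝ ι) := by
  rw [integral_eq_lintegral_of_nonneg_ae
    (ae_of_all _ fun x => mul_nonneg (Real.exp_pos _).le (hf0 _))
    (Measurable.aestronglyMeasurable (by fun_prop)),
    integral_eq_lintegral_of_nonneg_ae (ae_of_all _ hf0) hf.aestronglyMeasurable,
    ← lintegral_stdGaussian_translate (f := fun x => ENNReal.ofReal (f x)) (by fun_prop) w]
  simp_rw [ENNReal.ofReal_mul (Real.exp_pos _).le]

/-- The loss of a translation by `w` has exactly the law that defines `gaussianHockeyStick` with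
variance `‖w‖²`. -/
lemma stdGaussian_map_inner_add (w : EuclideanSpace ℝ ι) :
    (stdGaussian (EuclideanSpace ℝ ι)).map (fun x => inner ℝ w x + ‖w‖ ^ 2 / 2)
      = gaussianReal ((‖w‖₊ ^ 2 : ℝ≥0) / 2) (‖w‖₊ ^ 2) := by
  have h := IsGaussian.map_eq_gaussianReal (μ := stdGaussian (EuclideanSpace ℝ ι)) (innerSL ℝ w)
  rw [integral_strongDual_stdGaussian, variance_dual_stdGaussian, innerSL_apply_norm] at h
  have h2 := gaussianReal_map_add_const (μ := 0) (v := (‖w‖ ^ 2).toNNReal) (‖w‖ ^ 2 / 2)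
  rw [← h, Measure.map_map (by fun_prop) (by fun_prop)] at h2
  have hv : (‖w‖ ^ 2).toNNReal = ‖w‖₊ ^ 2 := by
    rw [Real.toNNReal_pow (norm_nonneg w), norm_toNNReal]
  rw [hv, zero_add] at h2
  simpa [Function.comp_def] using h2

/-- Needed to turn almost sure sensitivity bounds into pointwise ones. -/
instance : (stdGaussian (EuclideanSpace ℝ ι)).IsOpenPosMeasure := by
  have h1 : (gaussianReal 0 1).IsOpenPosMeasure :=
    (gaussianReal_absolutelyContinuous' 0 one_ne_zero).isOpenPosMeasure
  rw [← map_pi_eq_stdGaussian]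
  exact (PiLp.continuous_toLp 2 _).isOpenPosMeasure_map (WithLp.toLp_surjective 2)

end StdGaussian

/-! ### Hockey-stick comparison of Gaussian chains with shifted noises. -/

section GaussianChain

open scoped NNReal ENNReal

variable {ι : Type*} [Fintype ι]

/-- The law of `x + σ z` with `z` standard Gaussian. -/
noncomputable def gaussianNoise (σ : ℝ) (x : EuclideanSpace ℝ ι) : Measure (EuclideanSpace ℝ ι) :=
  (stdGaussian (EuclideanSpace ℝ ι)).map fun z => x + σ • z

instance (σ : ℝ) (x : EuclideanSpace ℝ ι) : IsProbabilityMeasure (gaussianNoise σ x) :=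
  Measure.isProbabilityMeasure_map (by fun_prop)

lemma measurable_gaussianNoise (σ : ℝ) :
    Measurable (gaussianNoise σ : EuclideanSpace ℝ ι → Measure (EuclideanSpace ℝ ι)) := by
  refine Measure.measurable_of_measurable_coe _ fun S hS => ?_
  have h : Measurable fun p : EuclideanSpace ℝ ι × EuclideanSpace ℝ ι => p.1 + σ • p.2 := by
    fun_prop
  have h2 := measurable_measure_prodMk_left (ν := stdGaussian (EuclideanSpace ℝ ι)) (h hS)
  convert h2 using 1
  ext x
  rw [gaussianNoise, Measure.map_apply (by fun_prop) hS]
  rfl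

/-- The law after `k` steps of the chain `x ↦ A k x + σ k z` with independent standard Gaussian
noises `z`. -/
noncomputable def gaussianChain (A : ℕ → EuclideanSpace ℝ ι → EuclideanSpace ℝ ι) (σ : ℕ → ℝ)
    (x₀ : EuclideanSpace ℝ ι) : ℕ → Measure (EuclideanSpace ℝ ι)
  | 0 => Measure.dirac x₀
  | k + 1 => (gaussianChain A σ x₀ k).bind fun x => gaussianNoise (σ k) (A k x)

lemma isProbabilityMeasure_bind {X Y : Type*} [MeasurableSpace X] [MeasurableSpace Y]
    {m : Measure X} [IsProbabilityMeasure m] {κ : X → Measure Y} (hκ : Measurable κ)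
    [∀ x, IsProbabilityMeasure (κ x)] : IsProbabilityMeasure (m.bind κ) :=
  ⟨by rw [Measure.bind_apply MeasurableSet.univ hκ.aemeasurable]; simp⟩

lemma integral_bind_of_mem_Icc {X Y : Type*} [MeasurableSpace X] [MeasurableSpace Y]
    {m : Measure X} [IsProbabilityMeasure m] {κ : X → Measure Y} (hκ : Measurable κ)
    [∀ x, IsProbabilityMeasure (κ x)] {f : Y → ℝ} (hf : Measurable f)
    (h : ∀ y, f y ∈ Set.Icc (0 : ℝ) 1) :
    Measurable (fun x => ∫ y, f y ∂κ x) ∧ ∫ y, f y ∂m.bind κ = ∫ x, ∫ y, f y ∂κ x ∂m := by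
  have hl : ∀ x, ENNReal.ofReal (∫ y, f y ∂κ x) = ∫⁻ y, ENNReal.ofReal (f y) ∂κ x := fun x =>
    ofReal_integral_eq_lintegral_ofReal (integrable_of_mem_Icc hf h) (ae_of_all _ fun y => (h y).1)
  have hm : Measurable (fun x => ∫ y, f y ∂κ x) := by
    have h1 : Measurable fun x => ∫⁻ y, ENNReal.ofReal (f y) ∂κ x :=
      (Measure.measurable_lintegral (by fun_prop)).comp hκ
    convert h1.ennreal_toReal using 1
    ext x
    rw [← hl, ENNReal.toReal_ofReal (integral_nonneg fun y => (h y).1)]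
  refine ⟨hm, ?_⟩
  rw [integral_eq_lintegral_of_nonneg_ae (ae_of_all _ fun y => (h y).1) hf.aestronglyMeasurable,
    integral_eq_lintegral_of_nonneg_ae
      (ae_of_all _ fun x => integral_nonneg fun y => (h y).1) hm.aestronglyMeasurable,
    Measure.lintegral_bind hκ.aemeasurable (by fun_prop)]
  simp_rw [hl]

instance isProbabilityMeasure_gaussianChain_zero
    (A : ℕ → EuclideanSpace ℝ ι → EuclideanSpace ℝ ι) (σ : ℕ → ℝ) (x₀ : EuclideanSpace ℝ ι) :
    IsProbabilityMeasure (gaussianChain A σ x₀ 0) :=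
  inferInstanceAs (IsProbabilityMeasure (Measure.dirac x₀))

lemma isProbabilityMeasure_gaussianChain {A : ℕ → EuclideanSpace ℝ ι → EuclideanSpace ℝ ι}
    (hA : ∀ k, Measurable (A k)) (σ : ℕ → ℝ) (x₀ : EuclideanSpace ℝ ι) :
    ∀ k, IsProbabilityMeasure (gaussianChain A σ x₀ k)
  | 0 => inferInstance
  | k + 1 =>
    have := isProbabilityMeasure_gaussianChain hA σ x₀ k
    isProbabilityMeasure_bind ((measurable_gaussianNoise (σ k)).comp (hA k))

/-- One step of the comparison: a translation of the noise by `w` costs variance `‖w‖²`. -/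
lemma hockeyStick_gaussianNoise_le {u q : EuclideanSpace ℝ ι → ℝ} (hu : Measurable u)
    (hu1 : ∀ x, u x ∈ Set.Icc (0 : ℝ) 1) (hq : Measurable q)
    (hq1 : ∀ x, q x ∈ Set.Icc (0 : ℝ) 1) {σ : ℝ} {a b w : EuclideanSpace ℝ ι} {v : ℝ≥0}
    (h : ∀ e, ∀ t : ℝ, 0 ≤ t →
      u (a + σ • e) - t * q (b + σ • (e + w)) ≤ gaussianHockeyStick v t)
    {t : ℝ} (ht : 0 ≤ t) :
    ∫ x, u x ∂gaussianNoise σ a - t * ∫ x, q x ∂gaussianNoise σ b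
      ≤ gaussianHockeyStick (‖w‖₊ ^ 2 + v) t := by
  have hint : Integrable (fun e => Real.exp (-(inner ℝ w e + ‖w‖ ^ 2 / 2))
      * q (b + σ • (e + w))) (stdGaussian (EuclideanSpace ℝ ι)) := by
    have h1 : Integrable (fun e => Real.exp (-(inner ℝ w e + ‖w‖ ^ 2 / 2)))
        (stdGaussian (EuclideanSpace ℝ ι)) := by
      have h2 := integrable_exp_neg_gaussianReal (‖w‖₊ ^ 2)
      rw [← stdGaussian_map_inner_add] at h2
      exact h2.comp_measurable (by fun_prop)
    refine h1.mul_bdd (c := 1) (Measurable.aestronglyMeasurable (by fun_prop))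
      (ae_of_all _ fun e => ?_)
    rw [Real.norm_of_nonneg (hq1 _).1]
    exact (hq1 _).2
  have hintu : Integrable (fun e => u (a + σ • e)) (stdGaussian (EuclideanSpace ℝ ι)) :=
    integrable_of_mem_Icc (by fun_prop) fun e => hu1 _
  have hH : Measurable fun s : ℝ => gaussianHockeyStick v (t * Real.exp (-s)) :=
    (measurable_gaussianHockeyStick v).comp (by fun_prop)
  -- Only the noise of the second chain is translated. Both integrals then run over the same `e`,
  -- and the density factor turns the level `t` into `t e^{-s}`, to which the pointwise bound
  -- applies.
  rw [gaussianNoise, gaussianNoise, integral_map (by fun_prop) hu.aestronglyMeasurable,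
    integral_map (by fun_prop) hq.aestronglyMeasurable,
    ← integral_stdGaussian_translate (f := fun e => q (b + σ • e)) (by fun_prop)
      (fun e => (hq1 _).1) w, ← integral_const_mul, ← integral_sub hintu (hint.const_mul t),
    ← integral_gaussianHockeyStick _ _ ht, ← stdGaussian_map_inner_add,
    integral_map (by fun_prop) hH.aestronglyMeasurable]
  refine integral_mono (hintu.sub (hint.const_mul t)) (integrable_of_mem_Icc (hH.comp (by fun_prop))
    fun e => gaussianHockeyStick_mem v (by positivity)) fun e => ?_
  have := h e (t * Real.exp (-(inner ℝ w e + ‖w‖ ^ 2 / 2))) (by positivity)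
  simpa [mul_assoc] using this

/-- Two chains driven by the same noise levels whose drifts can be kept in the relation `R` by
translating the noise of the `k`-th step by a vector of squared length at most `β k`. -/
lemma hockeyStick_gaussianChain_le {A B : ℕ → EuclideanSpace ℝ ι → EuclideanSpace ℝ ι}
    (hA : ∀ k, Measurable (A k)) (hB : ∀ k, Measurable (B k)) (σ : ℕ → ℝ)
    (x₀ : EuclideanSpace ℝ ι) {R : ℕ → EuclideanSpace ℝ ι → EuclideanSpace ℝ ι → Prop}
    (hR₀ : R 0 x₀ x₀) {β : ℕ → ℝ≥0} :
    ∀ {n : ℕ}, (∀ k < n, ∀ x y, R k x y → ∃ w : EuclideanSpace ℝ ι, ‖w‖₊ ^ 2 ≤ β k ∧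
      ∀ e, R (k + 1) (A k x + σ k • e) (B k y + σ k • (e + w))) →
    ∀ {u q : EuclideanSpace ℝ ι → ℝ}, Measurable u → (∀ x, u x ∈ Set.Icc (0 : ℝ) 1) →
      Measurable q → (∀ x, q x ∈ Set.Icc (0 : ℝ) 1) → ∀ {v : ℝ≥0},
      (∀ x y, R n x y → ∀ t : ℝ, 0 ≤ t → u x - t * q y ≤ gaussianHockeyStick v t) →
      ∀ {t : ℝ}, 0 ≤ t → ∫ x, u x ∂gaussianChain A σ x₀ n - t * ∫ x, q x ∂gaussianChain B σ x₀ n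
        ≤ gaussianHockeyStick (∑ k ∈ Finset.range n, β k + v) t := by
  intro n
  induction n with
  | zero =>
    intro _ u q _ _ _ _ v h t ht
    simpa [gaussianChain] using h x₀ x₀ hR₀ t ht
  | succ n ih =>
    intro hstep u q hu hu1 hq hq1 v h t ht
    have := isProbabilityMeasure_gaussianChain hA σ x₀ n
    have := isProbabilityMeasure_gaussianChain hB σ x₀ n
    have hAk : Measurable fun x => gaussianNoise (σ n) (A n x) :=
      (measurable_gaussianNoise (σ n)).comp (hA n)
    have hBk : Measurable fun x => gaussianNoise (σ n) (B n x) :=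
      (measurable_gaussianNoise (σ n)).comp (hB n)
    obtain ⟨hmA, hiA⟩ := integral_bind_of_mem_Icc (m := gaussianChain A σ x₀ n) hAk hu hu1
    obtain ⟨hmB, hiB⟩ := integral_bind_of_mem_Icc (m := gaussianChain B σ x₀ n) hBk hq hq1
    -- The last step is integrated out: `u` and `q` become different functions of the current states
    -- even if they were equal, and the cost `β n` is moved into `v`. Hence the statement allows two
    -- functions and an arbitrary `v`.
    have hfin := ih (fun k hk => hstep k (hk.trans n.lt_succ_self)) hmA
      (fun x => integral_mem_Icc hu hu1) hmB (fun x => integral_mem_Icc hq hq1)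
      (v := β n + v) (fun x y hxy t ht => by
        obtain ⟨w, hw, hR⟩ := hstep n n.lt_succ_self x y hxy
        refine (hockeyStick_gaussianNoise_le hu hu1 hq hq1 (w := w) (v := v)
          (fun e t ht => h _ _ (hR e) t ht) ht).trans ?_
        exact gaussianHockeyStick_mono (by gcongr) ht) ht
    rw [← hiA, ← hiB] at hfin
    rw [Finset.sum_range_succ, add_assoc]
    exact hfin

end GaussianChain

/-! ### Choice of the shifts: an optimisation problem on finite sequences. -/

section ShiftAllocation

open Finset

/-- The gap that remains after `k` steps when each step multiplies it by `c` and then changes it by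
`d k`, cut off at `0`. -/
noncomputable def greedyGap (c : ℝ) (d : ℕ → ℝ) : ℕ → ℝ
  | 0 => 0
  | k + 1 => max 0 (c * greedyGap c d k + d k)

lemma greedyGap_nonneg (c : ℝ) (d : ℕ → ℝ) : ∀ k, 0 ≤ greedyGap c d k
  | 0 => le_rfl
  | _ + 1 => le_max_left _ _

/-- Unrolled back to the last time the cut-off was active, the final gap is a weighted tail sum of
`d`. The invariant `key` carries this forward: an active cut-off restarts it from the tail
hypothesis. -/
lemma greedyGap_eq_zero {c : ℝ} {d : ℕ → ℝ} {n : ℕ}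
    (h : ∀ k ≤ n, ∑ j ∈ Ico k n, c ^ (n - (j + 1)) * d j ≤ 0) : greedyGap c d n = 0 := by
  have key : ∀ k ≤ n, c ^ (n - k) * greedyGap c d k
      + ∑ j ∈ Ico k n, c ^ (n - (j + 1)) * d j ≤ 0 := by
    intro k
    induction k with
    | zero => intro _; simpa [greedyGap] using h 0 (Nat.zero_le n)
    | succ k ih =>
      intro hk
      have hk' : k < n := hk
      have h1 := ih hk'.le
      rw [sum_eq_sum_Ico_succ_bot hk'] at h1
      rcases max_cases 0 (c * greedyGap c d k + d k) with ⟨he, -⟩ | ⟨he, -⟩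
      · simpa [greedyGap, he] using h (k + 1) hk
      · rw [greedyGap, he]
        rw [show n - k = n - (k + 1) + 1 by omega, pow_succ] at h1
        linarith
  refine le_antisymm ?_ (greedyGap_nonneg c d n)
  simpa using key n le_rfl

variable {w v : ℕ → ℝ} {T n : ℕ} {vl : ℝ}

/-- Splitting proportionally to `w * v` is admissible: the later indices carry the larger part. -/
lemma sum_tail_mul_le (hw : Monotone w) (hw0 : ∀ j, 0 ≤ w j) (hvl : 0 ≤ vl) (hv0 : ∀ j, 0 ≤ v j)
    (hv : ∀ j < T, v j = vl) (hTn : T ≤ n) {p k : ℕ} (hpk : p ≤ k) :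
    (∑ j ∈ Ico k T, w j) * ∑ j ∈ Ico p n, w j ^ 2 * v j
      ≤ (∑ j ∈ Ico p T, w j) * ∑ j ∈ Ico k n, w j ^ 2 * v j := by
  rcases le_or_gt T k with hTk | hkT
  · rw [Ico_eq_empty_of_le hTk, sum_empty, zero_mul]
    exact mul_nonneg (sum_nonneg fun j _ => hw0 j)
      (sum_nonneg fun j _ => mul_nonneg (sq_nonneg _) (hv0 j))
  rw [← sum_Ico_consecutive _ hpk (hkT.le.trans hTn), ← sum_Ico_consecutive _ hpk hkT.le]
  -- After cancelling the common products, `w k * vl` separates the two sides: it bounds the ratio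
  -- of `w j ^ 2 * v j` to `w j` from above before `k`, and from below on `Ico k T`.
  have h1 : ∑ j ∈ Ico p k, w j ^ 2 * v j ≤ w k * vl * ∑ j ∈ Ico p k, w j := by
    rw [mul_sum]
    refine sum_le_sum fun j hj => ?_
    have hjk := (mem_Ico.1 hj).2
    rw [hv j (hjk.trans hkT)]
    have := mul_le_mul_of_nonneg_right (hw hjk.le) (mul_nonneg (hw0 j) hvl)
    linarith
  have h2 : w k * vl * ∑ j ∈ Ico k T, w j ≤ ∑ j ∈ Ico k n, w j ^ 2 * v j := by
    rw [mul_sum]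
    refine (sum_le_sum fun j hj => ?_).trans (sum_le_sum_of_subset_of_nonneg
      (Ico_subset_Ico_right hTn) fun j _ _ => mul_nonneg (sq_nonneg _) (hv0 j))
    rw [hv j (mem_Ico.1 hj).2]
    have := mul_le_mul_of_nonneg_right (hw (mem_Ico.1 hj).1) (mul_nonneg (hw0 j) hvl)
    linarith
  have h3 := mul_le_mul_of_nonneg_left h1 (sum_nonneg fun j (_ : j ∈ Ico k T) => hw0 j)
  have h4 := mul_le_mul_of_nonneg_left h2 (sum_nonneg fun j (_ : j ∈ Ico p k) => hw0 j)
  linarith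

lemma tail_le_proportional (hw : Monotone w) (hw0 : ∀ j, 0 ≤ w j) (hvl : 0 < vl)
    (hv0 : ∀ j, 0 ≤ v j) (hv : ∀ j < T, v j = vl) (hTn : T ≤ n) {S : ℝ} (hS : 0 ≤ S) {p k : ℕ}
    (hpk : p ≤ k) :
    S * ∑ j ∈ Ico k T, w j ≤ S * (∑ j ∈ Ico p T, w j) / (∑ j ∈ Ico p n, w j ^ 2 * v j)
      * ∑ j ∈ Ico k n, w j ^ 2 * v j := by
  have hnn : ∀ j ∈ Ico p n, 0 ≤ w j ^ 2 * v j := fun j _ => mul_nonneg (sq_nonneg _) (hv0 j)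
  rcases (sum_nonneg hnn).eq_or_lt with h0 | hpos
  · have hz := (sum_eq_zero_iff_of_nonneg hnn).1 h0.symm
    have : ∑ j ∈ Ico k T, w j = 0 := sum_eq_zero fun j hj => by
      have hj' := mem_Ico.1 hj
      have h := hz j (mem_Ico.2 ⟨hpk.trans hj'.1, hj'.2.trans_le hTn⟩)
      rw [hv j hj'.2] at h
      simpa [hvl.ne'] using h
    rw [this, ← h0]
    simp
  · rw [div_mul_eq_mul_div, le_div_iff₀ hpos, mul_assoc, mul_assoc]
    exact mul_le_mul_of_nonneg_left (sum_tail_mul_le hw hw0 hvl.le hv0 hv hTn hpk) hS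

lemma sq_div_mul_mul_le {S B W D M : ℝ} (hW : 0 ≤ W) (h : B ^ 2 * D ≤ M ^ 2 * W) :
    (S * B / W) ^ 2 * W * D ≤ (S * M) ^ 2 := by
  rcases hW.eq_or_lt with rfl | hpos
  · simp
    positivity
  · have : (S * B / W) ^ 2 * W * D = S ^ 2 * (B ^ 2 * D) / W := by
      field_simp
    rw [this, div_le_iff₀ hpos]
    have := mul_le_mul_of_nonneg_left h (sq_nonneg S)
    linarith

/-- Shifts that absorb the sensitivities `a, S, …, S, 0, …, 0` at a cost of at most that of the
optimal shifts for the sensitivities `a, S, …, S, 0, …, 0` preceded by one more step. -/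
lemma exists_shift_allocation (hw : Monotone w) (hw0 : ∀ j, 0 ≤ w j) (hvl : 0 < vl)
    (hv0 : ∀ j, 0 < v j) (hv : ∀ j < T, v j = vl) (hT : 0 < T) (hTn : T ≤ n) {x a S : ℝ}
    (hx : 0 ≤ x) (hxw : x ≤ w 0) (ha : 0 ≤ a) (haS : a ≤ S) :
    ∃ α : ℕ → ℝ, (∀ j, 0 ≤ α j) ∧
      (∀ k ≤ n, ∑ j ∈ Ico k n, w j * ((if j = 0 then a else if j < T then S else 0) - α j) ≤ 0) ∧
      ∑ j ∈ range n, α j ^ 2 / v j ≤ (S * (∑ j ∈ range T, w j) + a * x) ^ 2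
        / (∑ j ∈ range n, w j ^ 2 * v j + vl * x ^ 2) := by
  have hn : 0 < n := hT.trans_le hTn
  have hS : 0 ≤ S := ha.trans haS
  set B := ∑ j ∈ Ico 1 T, w j with hB
  set W := ∑ j ∈ Ico 1 n, w j ^ 2 * v j with hW
  have hB0 : 0 ≤ B := sum_nonneg fun j _ => hw0 j
  have hW0 : 0 ≤ W := sum_nonneg fun j _ => mul_nonneg (sq_nonneg _) (hv0 j).le
  have hC : ∑ j ∈ Ico 0 T, w j = w 0 + B := sum_eq_sum_Ico_succ_bot hT _
  have hV : ∑ j ∈ Ico 0 n, w j ^ 2 * v j = w 0 ^ 2 * vl + W := by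
    rw [sum_eq_sum_Ico_succ_bot hn, hv 0 hT]
  have hw00 := hw0 0
  have hV0 : 0 ≤ w 0 ^ 2 * vl + W := by positivity
  -- `κ₁` and `κ₀` are the Cauchy–Schwarz constants for sensitivity `S` from step `0` and from step
  -- `1` on. With `a = t * S` the actual profile is the convex combination of these two with weight
  -- `t`, and so are the shifts; this preserves the tail constraints.
  set κ₁ := S * (w 0 + B) / (w 0 ^ 2 * vl + W) with hκ₁
  set κ₀ := S * B / W with hκ₀
  have hκ₁0 : 0 ≤ κ₁ := by positivity
  have hκ₀0 : 0 ≤ κ₀ := by positivity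
  obtain ⟨t, ht0, ht1, hat⟩ : ∃ t : ℝ, 0 ≤ t ∧ t ≤ 1 ∧ a = t * S := by
    rcases hS.eq_or_lt with h0 | hpos
    · exact ⟨0, le_rfl, zero_le_one, by rw [zero_mul]; linarith⟩
    · exact ⟨a / S, by positivity, (div_le_one hpos).2 haS, by field_simp⟩
  set κ := t * κ₁ + (1 - t) * κ₀ with hκ
  have hκ0 : 0 ≤ κ := add_nonneg (mul_nonneg ht0 hκ₁0) (mul_nonneg (by linarith) hκ₀0)
  have tail₁ : ∀ k, S * ∑ j ∈ Ico k T, w j ≤ κ₁ * ∑ j ∈ Ico k n, w j ^ 2 * v j := fun k => by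
    have := tail_le_proportional hw hw0 hvl (fun j => (hv0 j).le) hv hTn hS (Nat.zero_le k)
    rwa [hC, hV] at this
  have tail₀ : ∀ k, 1 ≤ k → S * ∑ j ∈ Ico k T, w j ≤ κ₀ * ∑ j ∈ Ico k n, w j ^ 2 * v j :=
    fun k hk => tail_le_proportional hw hw0 hvl (fun j => (hv0 j).le) hv hTn hS hk
  have tail_pos : ∀ k, 1 ≤ k → ∑ j ∈ Ico k n, w j * (if j = 0 then a else if j < T then S else 0)
      = S * ∑ j ∈ Ico k T, w j := by
    intro k hk
    rw [mul_sum]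
    refine Eq.symm (sum_subset_zero_on_sdiff (Ico_subset_Ico_right hTn) (fun j hj => ?_)
      fun j hj => ?_)
    · simp only [mem_sdiff, mem_Ico, not_and, not_lt] at hj
      have h1 : j ≠ 0 := by omega
      have h2 : ¬ j < T := not_lt.2 (hj.2 hj.1.1)
      simp [h1, h2]
    · have h := mem_Ico.1 hj
      have h1 : j ≠ 0 := by omega
      simp [h1, h.2, mul_comm]
  refine ⟨fun j => (if j = 0 then t * κ₁ else κ) * (w j * v j), fun j => ?_, fun k hk => ?_, ?_⟩
  · refine mul_nonneg ?_ (mul_nonneg (hw0 j) (hv0 j).le)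
    split_ifs
    · exact mul_nonneg ht0 hκ₁0
    · exact hκ0
  · have hα : ∀ k, 1 ≤ k → ∑ j ∈ Ico k n, w j * ((if j = 0 then t * κ₁ else κ) * (w j * v j))
        = κ * ∑ j ∈ Ico k n, w j ^ 2 * v j := by
      intro k hk
      rw [mul_sum]
      refine sum_congr rfl fun j hj => ?_
      have h1 : j ≠ 0 := by have := (mem_Ico.1 hj).1; omega
      rw [if_neg h1]
      ring
    have hcomb : ∀ k, 1 ≤ k → S * ∑ j ∈ Ico k T, w j ≤ κ * ∑ j ∈ Ico k n, w j ^ 2 * v j := by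
      intro k hk
      have h1 := mul_le_mul_of_nonneg_left (tail₁ k) ht0
      have h2 := mul_le_mul_of_nonneg_left (tail₀ k hk) (sub_nonneg.2 ht1)
      rw [hκ]
      linarith
    simp_rw [mul_sub]
    rw [sum_sub_distrib, sub_nonpos]
    rcases Nat.eq_zero_or_pos k with rfl | hk1
    · rw [sum_eq_sum_Ico_succ_bot hn, sum_eq_sum_Ico_succ_bot hn, zero_add,
        tail_pos 1 le_rfl, hα 1 le_rfl, if_pos rfl, if_pos rfl, ← hB, ← hW, hv 0 hT, hat, hκ]
      have h1 := mul_le_mul_of_nonneg_left (tail₁ 0) ht0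
      have h2 := mul_le_mul_of_nonneg_left (tail₀ 1 le_rfl) (sub_nonneg.2 ht1)
      rw [hC, hV] at h1
      rw [← hB, ← hW] at h2
      linarith
    · rw [tail_pos k hk1, hα k hk1]
      exact hcomb k hk1
  · have hcost : ∑ j ∈ range n, ((if j = 0 then t * κ₁ else κ) * (w j * v j)) ^ 2 / v j
        = (t * κ₁) ^ 2 * (w 0 ^ 2 * vl) + κ ^ 2 * W := by
      rw [range_eq_Ico, sum_eq_sum_Ico_succ_bot hn, if_pos rfl, hv 0 hT, zero_add, hW, mul_sum]
      congr 1
      · field_simp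
      · refine sum_congr rfl fun j hj => ?_
        have h1 : j ≠ 0 := by have := (mem_Ico.1 hj).1; omega
        have := (hv0 j).ne'
        rw [if_neg h1]
        field_simp
    rw [hcost, range_eq_Ico, range_eq_Ico, hC, hV]
    set D := w 0 ^ 2 * vl + W + vl * x ^ 2 with hD
    have hD0 : 0 ≤ D := by positivity
    have hBW : w 0 * vl * B ≤ W := by
      rw [hB, hW, mul_sum]
      refine (sum_le_sum fun j hj => ?_).trans (sum_le_sum_of_subset_of_nonneg
        (Ico_subset_Ico_right hTn) fun j _ _ => mul_nonneg (sq_nonneg _) (hv0 j).le)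
      rw [hv j (mem_Ico.1 hj).2]
      have := mul_le_mul_of_nonneg_right (hw (Nat.zero_le j)) (mul_nonneg (hw0 j) hvl.le)
      linarith
    have hxx : x ^ 2 ≤ w 0 ^ 2 := pow_le_pow_left₀ hx hxw 2
    -- A further earlier step of weight `x ≤ w 0` and equal variance does not decrease the ratio `(∑
    -- w)² / ∑ w² v`.
    have q₁ : (w 0 + B) ^ 2 * D ≤ (w 0 + B + x) ^ 2 * (w 0 ^ 2 * vl + W) := by
      have h1 : vl * x * (w 0 + B) ≤ w 0 ^ 2 * vl + W := by
        have := mul_le_mul_of_nonneg_right hxw (mul_nonneg hvl.le (add_nonneg hw00 hB0))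
        linarith
      have h2 := mul_le_mul_of_nonneg_left h1 (mul_nonneg hx (add_nonneg hw00 hB0))
      have h3 : 0 ≤ (x * (w 0 + B) + x ^ 2) * (w 0 ^ 2 * vl + W) := by positivity
      rw [hD]
      linarith
    -- Here the variance gains both `w 0 ^ 2` and `x ^ 2`, but the numerator only `w 0`; since `x ≤
    -- w 0` and `w 0 * vl * B ≤ W`, the cross term `2 * w 0 * B` suffices.
    have q₀ : B ^ 2 * D ≤ (w 0 + B) ^ 2 * W := by
      have h1 := mul_le_mul_of_nonneg_left hBW (mul_nonneg hw00 hB0)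
      have h2 := mul_le_mul_of_nonneg_left hxx (mul_nonneg hvl.le (sq_nonneg B))
      have h3 : 0 ≤ w 0 ^ 2 * W := by positivity
      rw [hD]
      linarith
    have Q₁ : κ₁ ^ 2 * (w 0 ^ 2 * vl + W) * D ≤ (S * (w 0 + B + x)) ^ 2 :=
      sq_div_mul_mul_le hV0 q₁
    have Q₀ : κ₀ ^ 2 * W * D ≤ (S * (w 0 + B)) ^ 2 := sq_div_mul_mul_le hW0 q₀
    -- The cross term of the cost is the geometric mean of two quantities bounded by `Q₁` and `Q₀`,
    -- so the total cost is bounded by a perfect square.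
    have Q₀₁ : κ₁ * κ₀ * W * D ≤ S * (w 0 + B + x) * (S * (w 0 + B)) := by
      refine abs_le_of_sq_le_sq' ?_ (by positivity) |>.2
      have h1 : κ₁ ^ 2 * W * D ≤ (S * (w 0 + B + x)) ^ 2 := by
        refine le_trans ?_ Q₁
        gcongr
        have : 0 ≤ w 0 ^ 2 * vl := by positivity
        linarith
      have h2 := mul_le_mul h1 Q₀ (by positivity) (by positivity)
      calc (κ₁ * κ₀ * W * D) ^ 2 = κ₁ ^ 2 * W * D * (κ₀ ^ 2 * W * D) := by ring
        _ ≤ _ := h2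
        _ = _ := by ring
    have hmain : ((t * κ₁) ^ 2 * (w 0 ^ 2 * vl) + κ ^ 2 * W) * D
        ≤ (S * (w 0 + B) + a * x) ^ 2 := by
      have e1 := mul_le_mul_of_nonneg_left Q₁ (sq_nonneg t)
      have e2 := mul_le_mul_of_nonneg_left Q₀₁ (mul_nonneg ht0 (sub_nonneg.2 ht1))
      have e3 := mul_le_mul_of_nonneg_left Q₀ (sq_nonneg (1 - t))
      rw [hκ, hat]
      linarith
    rcases hD0.eq_or_lt with h0 | hpos
    · have hW' : W = 0 := by
        have h1 : 0 ≤ w 0 ^ 2 * vl := by positivity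
        have h2 : 0 ≤ vl * x ^ 2 := by positivity
        linarith
      have hV' : w 0 ^ 2 * vl = 0 := by
        have h1 : 0 ≤ w 0 ^ 2 * vl := by positivity
        have h2 : 0 ≤ vl * x ^ 2 := by positivity
        linarith
      rw [← h0, hW', hV']
      simp
    · rwa [le_div_iff₀ hpos]

end ShiftAllocation

/-! ### From shifts that close the gap to a hockey-stick bound. -/

section ContractiveChain

open scoped NNReal ENNReal

variable {ι : Type*} [Fintype ι]

lemma exists_split_of_norm_le {E : Type*} [NormedAddCommGroup E] [NormedSpace ℝ E] {d : E}
    {r α : ℝ} (hα : 0 ≤ α) (hd : ‖d‖ ≤ r) : ∃ b : E, ‖b‖ ≤ α ∧ ‖d - b‖ ≤ max 0 (r - α) := by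
  rcases le_or_gt ‖d‖ α with h | h
  · exact ⟨d, h, by simp⟩
  · have hpos : 0 < ‖d‖ := hα.trans_lt h
    have hr : 0 ≤ 1 - α / ‖d‖ := sub_nonneg.2 ((div_le_one hpos).2 h.le)
    refine ⟨(α / ‖d‖) • d, ?_, ?_⟩
    · rw [norm_smul, Real.norm_of_nonneg (by positivity), div_mul_cancel₀ _ hpos.ne']
    · have : d - (α / ‖d‖) • d = (1 - α / ‖d‖) • d := by rw [sub_smul, one_smul]
      rw [this, norm_smul, Real.norm_of_nonneg hr, sub_mul, div_mul_cancel₀ _ hpos.ne', one_mul]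
      exact le_max_of_le_right (by linarith)

/-- Hockey-stick bound between two Gaussian chains whose drifts contract by `c` up to the
sensitivities `s k`, for shifts `α k` that absorb all the sensitivities. -/
lemma hockeyStick_gaussianChain_le_of_contraction
    {A B : ℕ → EuclideanSpace ℝ ι → EuclideanSpace ℝ ι}
    (hA : ∀ k, Measurable (A k)) (hB : ∀ k, Measurable (B k)) {σ : ℕ → ℝ} (hσ : ∀ k, 0 < σ k)
    {x₀ : EuclideanSpace ℝ ι} {c : ℝ} (hc : 0 ≤ c) {s α : ℕ → ℝ} (hα : ∀ k, 0 ≤ α k) {n : ℕ}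
    (hAB : ∀ k x y, (k = 0 → x = x₀ ∧ y = x₀) → ‖A k x - B k y‖ ≤ c * ‖x - y‖ + s k)
    (htail : ∀ k ≤ n, ∑ j ∈ Finset.Ico k n, c ^ (n - (j + 1)) * (s j - α j) ≤ 0)
    {μ : ℝ} (hcost : ∑ j ∈ Finset.range n, α j ^ 2 / σ j ^ 2 ≤ μ ^ 2)
    {u : EuclideanSpace ℝ ι → ℝ} (hu : IsTest u) {t : ℝ} (ht : 0 ≤ t) :
    ∫ x, u x ∂gaussianChain A σ x₀ n - t * ∫ x, u x ∂gaussianChain B σ x₀ n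
      ≤ gaussianHockeyStick (.mk (μ ^ 2) (sq_nonneg μ)) t := by
  set z := greedyGap c fun k => s k - α k with hz
  have hzn : z n = 0 := greedyGap_eq_zero htail
  let β : ℕ → ℝ≥0 := fun k => .mk (α k ^ 2 / σ k ^ 2) (by positivity)
  have hβ : ∑ k ∈ Finset.range n, β k + 0 ≤ .mk (μ ^ 2) (sq_nonneg μ) := by
    rw [← NNReal.coe_le_coe]
    push_cast
    simpa [β] using hcost
  -- The second clause of `R` remembers the common start, so that `s 0` need only bound the
  -- sensitivity at `x₀`. At time `n` the gap is `0`, the states coincide and no cost is left (`v :=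
  -- 0`).
  refine (hockeyStick_gaussianChain_le hA hB σ x₀ (β := β)
    (R := fun k x y => ‖x - y‖ ≤ z k ∧ (k = 0 → x = x₀ ∧ y = x₀)) ⟨by simp [hz, greedyGap], fun _ =>
      ⟨rfl, rfl⟩⟩ (fun k _ x y hxy => ?_) hu.1 hu.mem_Icc hu.1 hu.mem_Icc (v := 0)
      (fun x y hxy t _ => ?_) ht).trans (gaussianHockeyStick_mono hβ ht)
  · have hd : ‖A k x - B k y‖ ≤ c * z k + s k :=
      (hAB k x y hxy.2).trans (add_le_add (mul_le_mul_of_nonneg_left hxy.1 hc) le_rfl)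
    obtain ⟨b, hb, hdb⟩ := exists_split_of_norm_le (hα k) hd
    have hσk := hσ k
    refine ⟨(σ k)⁻¹ • b, ?_, fun e => ⟨?_, fun h => absurd h k.succ_ne_zero⟩⟩
    · rw [← NNReal.coe_le_coe]
      push_cast
      rw [norm_smul, Real.norm_of_nonneg (by positivity), mul_pow, inv_pow, inv_mul_eq_div]
      simp only [β, NNReal.coe_mk]
      gcongr
    · have : A k x + σ k • e - (B k y + σ k • (e + (σ k)⁻¹ • b)) = A k x - B k y - b := by
        rw [smul_add, smul_inv_smul₀ hσk.ne']
        abel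
      rw [this, hz, greedyGap]
      convert hdb using 2
      ring
  · have hxy' : x = y := by
      have h := hxy.1
      rw [hzn] at h
      exact sub_eq_zero.1 (norm_le_zero_iff.1 h)
    rw [← hxy', gaussianHockeyStick_zero]
    have h1 := hu.2 x
    rcases le_total t 1 with h | h
    · exact le_max_of_le_right (by nlinarith)
    · exact le_max_of_le_left (by nlinarith)

end ContractiveChain

/-! ### Matching the cost of the shifts with `muGDP`. -/

section PrivacyParameter

/-- Index shift: the bound `s (j + 1)` is charged to step `j`, whose weight is `c ^ (T + K - (j +
1))`, and `s 0` to the extra term of weight `c ^ (T + K)`. -/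
lemma sum_weights_le {c a S : ℝ} {T K : ℕ} {s : ℕ → ℝ} (hc : 0 ≤ c) (ha : a ≤ s 0)
    (hS : ∀ k, 1 ≤ k → k ≤ T → S ≤ s k) :
    S * (∑ j ∈ Finset.range T, c ^ (T + K - (j + 1))) + a * c ^ (T + K)
      ≤ ∑ k ∈ Finset.range (T + 1), c ^ (T + K - k) * s k := by
  rw [Finset.sum_range_succ', Nat.sub_zero, Finset.mul_sum]
  refine add_le_add (Finset.sum_le_sum fun j hj => ?_) ?_
  · have := hS (j + 1) (by omega) (Finset.mem_range.1 hj)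
    rw [mul_comm]
    gcongr
  · rw [mul_comm]
    gcongr

/-- For `k ≥ 1` the `k`-th summand belongs to the noise of step `k - 1`. The summand `k = 0` belongs
to no step of the chain and is kept apart. -/
lemma vLearn_add_vUnlearn (η σl σu c : ℝ) (T K : ℕ) :
    vLearn η σl c T K + vUnlearn η σu c T K
      = ∑ j ∈ Finset.range (T + K), (c ^ (T + K - (j + 1))) ^ 2
          * (if j < T then 2 * η * σl ^ 2 else 2 * η * σu ^ 2)
        + 2 * η * σl ^ 2 * (c ^ (T + K)) ^ 2 := by
  have hIcc : ∀ (f : ℕ → ℝ) (K : ℕ),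
      ∑ k ∈ Finset.Icc (T + 1) (T + K), f k = ∑ j ∈ Finset.range K, f (T + j + 1) := by
    intro f K
    induction K with
    | zero => simp
    | succ K ih =>
      rw [← add_assoc, Finset.sum_Icc_succ_top (by omega), ih, Finset.sum_range_succ]
  rw [vLearn, vUnlearn, Finset.sum_range_succ', Finset.sum_range_add, hIcc, add_right_comm]
  congr 1
  · congr 1
    · refine Finset.sum_congr rfl fun j hj => ?_
      rw [if_pos (Finset.mem_range.1 hj), pow_mul', mul_comm]
    · refine Finset.sum_congr rfl fun j hj => ?_
      rw [if_neg (by omega), pow_mul', mul_comm]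
  · rw [Nat.sub_zero, pow_mul']

lemma muGDP_nonneg {η σl σu c : ℝ} {T K : ℕ} {s : ℕ → ℝ} (hc : 0 ≤ c)
    (hs : ∀ k ≤ T, 0 ≤ s k) : 0 ≤ muGDP η σl σu c T K s :=
  div_nonneg (Finset.sum_nonneg fun k hk =>
    mul_nonneg (pow_nonneg hc _) (hs k (Nat.lt_succ_iff.1 (Finset.mem_range.1 hk))))
    (Real.sqrt_nonneg _)

lemma sq_muGDP {η σl σu c : ℝ} {T K : ℕ} {s : ℕ → ℝ} (hη : 0 ≤ η) :
    muGDP η σl σu c T K s ^ 2 = (∑ k ∈ Finset.range (T + 1), c ^ (T + K - k) * s k) ^ 2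
      / (vLearn η σl c T K + vUnlearn η σu c T K) := by
  rw [muGDP, div_pow, Real.sq_sqrt]
  refine add_nonneg (Finset.sum_nonneg fun k _ => ?_) (Finset.sum_nonneg fun k _ => ?_)
  all_goals
    rw [pow_mul']
    positivity

/-- The shifts for the Langevin trajectories, at a cost of at most `muGDP ^ 2`. -/
lemma exists_shift_le_muGDP {η σl σu c a S : ℝ} {T K : ℕ} {s : ℕ → ℝ} (hη : 0 < η)
    (hσl : 0 < σl) (hσu : 0 < σu) (hc : 0 ≤ c) (hc1 : c ≤ 1) (hT : 0 < T) (ha : 0 ≤ a)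
    (haS : a ≤ S) (has : a ≤ s 0) (hS : ∀ k, 1 ≤ k → k ≤ T → S ≤ s k) :
    ∃ α : ℕ → ℝ, (∀ j, 0 ≤ α j) ∧
      (∀ k ≤ T + K, ∑ j ∈ Finset.Ico k (T + K), c ^ (T + K - (j + 1))
        * ((if j = 0 then a else if j < T then S else 0) - α j) ≤ 0) ∧
      ∑ j ∈ Finset.range (T + K), α j ^ 2
        / (if j < T then 2 * η * σl ^ 2 else 2 * η * σu ^ 2)
        ≤ muGDP η σl σu c T K s ^ 2 := by
  have hmono : Monotone fun j => c ^ (T + K - (j + 1)) := fun i j hij =>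
    pow_le_pow_of_le_one hc hc1 (by omega)
  obtain ⟨α, hα, htail, hcost⟩ := exists_shift_allocation (T := T) (n := T + K)
    (w := fun j => c ^ (T + K - (j + 1)))
    (v := fun j => if j < T then 2 * η * σl ^ 2 else 2 * η * σu ^ 2) (vl := 2 * η * σl ^ 2)
    hmono (fun j => pow_nonneg hc _) (by positivity)
    (fun j => by split_ifs <;> positivity) (fun j hj => if_pos hj) hT (by omega)
    (x := c ^ (T + K)) (pow_nonneg hc _) (pow_le_pow_of_le_one hc hc1 (by omega)) ha haS
  refine ⟨α, hα, htail, hcost.trans ?_⟩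
  rw [sq_muGDP hη.le, vLearn_add_vUnlearn]
  refine div_le_div_of_nonneg_right (pow_le_pow_left₀ ?_ (sum_weights_le hc has hS) 2) ?_
  · have := ha.trans haS
    exact add_nonneg (mul_nonneg this (Finset.sum_nonneg fun j _ => pow_nonneg hc _))
      (mul_nonneg ha (pow_nonneg hc _))
  · refine add_nonneg (Finset.sum_nonneg fun j _ => mul_nonneg (sq_nonneg _) ?_) (by positivity)
    split_ifs <;> positivity

end PrivacyParameter

/-! ### Laws of the trajectories as Gaussian chains. -/

section LangevinLaws

open scoped NNReal ENNReal

variable {ι : Type*} [Fintype ι]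

/-- The noiseless part of the `k`-th step of `trajectory`. -/
noncomputable def langevinDrift (f g : EuclideanSpace ℝ ι → ℝ) (η : ℝ) (T k : ℕ) (x : EuclideanSpace ℝ ι) :
    EuclideanSpace ℝ ι :=
  if k < T then x - η • ∇ f x else x - η • ∇ g x

/-- The noise level of the `k`-th step of `trajectory`. -/
noncomputable def langevinNoise (η σl σu : ℝ) (T k : ℕ) : ℝ :=
  if k < T then Real.sqrt (2 * η * σl ^ 2) else Real.sqrt (2 * η * σu ^ 2)

lemma langevinNoise_pos {η σl σu : ℝ} (hη : 0 < η) (hσl : 0 < σl) (hσu : 0 < σu) (T k : ℕ) :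
    0 < langevinNoise η σl σu T k := by
  unfold langevinNoise
  split_ifs <;> positivity

lemma sq_langevinNoise {η : ℝ} (hη : 0 ≤ η) (σl σu : ℝ) (T k : ℕ) :
    langevinNoise η σl σu T k ^ 2 = if k < T then 2 * η * σl ^ 2 else 2 * η * σu ^ 2 := by
  unfold langevinNoise
  split_ifs <;> rw [Real.sq_sqrt (by positivity)]

lemma measurable_langevinDrift {f g : EuclideanSpace ℝ ι → ℝ} (hf : Measurable (∇ f))
    (hg : Measurable (∇ g)) (η : ℝ) (T k : ℕ) : Measurable (langevinDrift f g η T k) := by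
  unfold langevinDrift
  split_ifs <;> fun_prop

lemma trajectory_succ {Ω : Type*} (f g : EuclideanSpace ℝ ι → ℝ) (η σl σu : ℝ) (T : ℕ)
    (θ₀ : EuclideanSpace ℝ ι) (ξ : ℕ → Ω → EuclideanSpace ℝ ι) (k : ℕ) (ω : Ω) :
    trajectory f g η σl σu T θ₀ ξ (k + 1) ω
      = langevinDrift f g η T k (trajectory f g η σl σu T θ₀ ξ k ω)
        + langevinNoise η σl σu T k • ξ k ω := by
  rw [trajectory, langevinDrift, langevinNoise]
  split_ifs <;> rfl

lemma map_prod_eq_bind {X Y Z : Type*} [MeasurableSpace X] [MeasurableSpace Y]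
    [MeasurableSpace Z] (m : Measure X) (ν : Measure Y) [SFinite ν] {g : X × Y → Z}
    (hg : Measurable g) (hκ : Measurable fun x => ν.map fun y => g (x, y)) :
    (m.prod ν).map g = m.bind fun x => ν.map fun y => g (x, y) := by
  ext S hS
  rw [Measure.map_apply hg hS, Measure.prod_apply (hg hS), Measure.bind_apply hS hκ.aemeasurable]
  refine lintegral_congr fun x => ?_
  rw [Measure.map_apply (by fun_prop) hS]
  rfl

/-- The iterate `θ_k` is a measurable function of the first `k` noises. -/
lemma exists_trajectory_eq {Ω : Type*} {f g : EuclideanSpace ℝ ι → ℝ} (hf : Measurable (∇ f))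
    (hg : Measurable (∇ g)) (η σl σu : ℝ) (T : ℕ) (θ₀ : EuclideanSpace ℝ ι)
    (ξ : ℕ → Ω → EuclideanSpace ℝ ι) (k : ℕ) :
    ∃ F : (Finset.range k → EuclideanSpace ℝ ι) → EuclideanSpace ℝ ι, Measurable F ∧
      trajectory f g η σl σu T θ₀ ξ k = fun ω => F fun j => ξ j ω := by
  induction k with
  | zero => exact ⟨fun _ => θ₀, measurable_const, rfl⟩
  | succ k ih =>
    obtain ⟨F, hF, hFt⟩ := ih
    have hd := measurable_langevinDrift hf hg η T k
    refine ⟨fun p => langevinDrift f g η T k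
      (F fun j => p ⟨j, Finset.range_subset_range.2 k.le_succ j.2⟩)
      + langevinNoise η σl σu T k • p ⟨k, Finset.self_mem_range_succ k⟩, ?_, ?_⟩
    · have h1 : Measurable fun p : Finset.range (k + 1) → EuclideanSpace ℝ ι =>
          F fun j => p ⟨j, Finset.range_subset_range.2 k.le_succ j.2⟩ :=
        hF.comp (measurable_pi_lambda _ fun j => measurable_pi_apply _)
      have h2 : Measurable fun p : Finset.range (k + 1) → EuclideanSpace ℝ ι =>
          p ⟨k, Finset.self_mem_range_succ k⟩ := measurable_pi_apply _
      exact (hd.comp h1).add (h2.fun_const_smul _)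
    · ext1 ω
      rw [trajectory_succ, hFt]

lemma map_trajectory {Ω : Type*} [MeasurableSpace Ω] {P : Measure Ω} [IsProbabilityMeasure P]
    {f g : EuclideanSpace ℝ ι → ℝ} (hf : Measurable (∇ f)) (hg : Measurable (∇ g))
    (η σl σu : ℝ) (T : ℕ) (θ₀ : EuclideanSpace ℝ ι) {ξ : ℕ → Ω → EuclideanSpace ℝ ι}
    (hξ : ∀ k, HasLaw (ξ k) (stdGaussian (EuclideanSpace ℝ ι)) P) (hξi : iIndepFun ξ P) (k : ℕ) :
    P.map (trajectory f g η σl σu T θ₀ ξ k)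
      = gaussianChain (langevinDrift f g η T) (langevinNoise η σl σu T) θ₀ k := by
  induction k with
  | zero =>
    have : trajectory f g η σl σu T θ₀ ξ 0 = fun _ => θ₀ := rfl
    rw [this, Measure.map_const]
    simp [gaussianChain]
  | succ k ih =>
    obtain ⟨F, hF, hFt⟩ := exists_trajectory_eq hf hg η σl σu T θ₀ ξ k
    have hm : ∀ j, AEMeasurable (ξ j) P := fun j => (hξ j).aemeasurable
    have hmt : AEMeasurable (trajectory f g η σl σu T θ₀ ξ k) P := by
      rw [hFt]
      exact hF.comp_aemeasurable (aemeasurable_pi_lambda _ fun j => hm j)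
    have hind : IndepFun (trajectory f g η σl σu T θ₀ ξ k) (ξ k) P := by
      -- The noise `ξ k` is independent of all earlier noises jointly, hence of the iterate, which
      -- is a function of them.
      have h := hξi.indepFun_finset₀ (Finset.range k) {k} (by simp) hm
      have h2 := h.comp hF (measurable_pi_apply (⟨k, Finset.mem_singleton_self k⟩ :
        ({k} : Finset ℕ)))
      rw [hFt]
      exact h2
    have hpair := (indepFun_iff_map_prod_eq_prod_map_map hmt (hm k)).1 hind
    rw [ih, (hξ k).map_eq] at hpair
    have hd := measurable_langevinDrift hf hg η T k
    have hg' : Measurable fun p : EuclideanSpace ℝ ι × EuclideanSpace ℝ ι =>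
        langevinDrift f g η T k p.1 + langevinNoise η σl σu T k • p.2 := by fun_prop
    have hstep : trajectory f g η σl σu T θ₀ ξ (k + 1)
        = (fun p : EuclideanSpace ℝ ι × EuclideanSpace ℝ ι =>
          langevinDrift f g η T k p.1 + langevinNoise η σl σu T k • p.2)
          ∘ fun ω => (trajectory f g η σl σu T θ₀ ξ k ω, ξ k ω) :=
      funext fun ω => trajectory_succ f g η σl σu T θ₀ ξ k ω
    rw [hstep, ← AEMeasurable.map_map_of_aemeasurable hg'.aemeasurable (hmt.prodMk (hm k)), hpair,
      map_prod_eq_bind _ _ hg' ((measurable_gaussianNoise _).comp hd)]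
    rfl

lemma measurable_langevinLaw {f : EuclideanSpace ℝ ι → ℝ} (hf : Measurable (∇ f)) (η σ : ℝ)
    (k : ℕ) : Measurable (langevinLaw f η σ k) := by
  induction k with
  | zero => exact Measure.measurable_dirac
  | succ k ih =>
    have h : Measurable fun θ => (stdGaussian (EuclideanSpace ℝ ι)).map (langevinStep f η σ θ) :=
      (measurable_gaussianNoise (Real.sqrt (2 * η * σ ^ 2))).comp
        (show Measurable fun θ => θ - η • ∇ f θ by fun_prop)
    exact (Measure.measurable_bind' h).comp ih

lemma gaussianChain_eq_langevinLaw (f g : EuclideanSpace ℝ ι → ℝ) (η σl σu : ℝ) {T : ℕ}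
    (θ₀ : EuclideanSpace ℝ ι) {k : ℕ} (hk : k ≤ T) :
    gaussianChain (langevinDrift f g η T) (langevinNoise η σl σu T) θ₀ k
      = langevinLaw f η σl k θ₀ := by
  induction k with
  | zero => rfl
  | succ k ih =>
    rw [gaussianChain, langevinLaw, ih (by omega)]
    have hkT : k < T := hk
    simp only [langevinDrift, langevinNoise, if_pos hkT]
    rfl

/-- Learning on `f` followed by unlearning on `g`, as one chain. -/
lemma bind_langevinLaw (f : EuclideanSpace ℝ ι → ℝ) {g : EuclideanSpace ℝ ι → ℝ}
    (hg : Measurable (∇ g)) (η σl σu : ℝ) (T K : ℕ) (θ₀ : EuclideanSpace ℝ ι) :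
    (langevinLaw f η σl T θ₀).bind (langevinLaw g η σu K)
      = gaussianChain (langevinDrift f g η T) (langevinNoise η σl σu T) θ₀ (T + K) := by
  induction K with
  | zero =>
    rw [add_zero, gaussianChain_eq_langevinLaw f g η σl σu θ₀ le_rfl]
    exact Measure.bind_dirac
  | succ K ih =>
    have h : Measurable fun θ => (stdGaussian (EuclideanSpace ℝ ι)).map (langevinStep g η σu θ) :=
      (measurable_gaussianNoise (Real.sqrt (2 * η * σu ^ 2))).comp
        (show Measurable fun θ => θ - η • ∇ g θ by fun_prop)
    have hstep : (fun θ => gaussianNoise (langevinNoise η σl σu T (T + K))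
        (langevinDrift f g η T (T + K) θ))
        = fun θ => (stdGaussian (EuclideanSpace ℝ ι)).map (langevinStep g η σu θ) := by
      have hkT : ¬ T + K < T := by omega
      simp only [langevinDrift, langevinNoise, if_neg hkT]
      rfl
    rw [← add_assoc, gaussianChain, hstep, ← ih, Measure.bind_bind
      (measurable_langevinLaw hg η σu K).aemeasurable h.aemeasurable]
    rfl

/-- A continuous bound that holds almost surely along a Gaussian chain holds everywhere. -/
lemma le_of_ae_gaussianChain_succ {A : ℕ → EuclideanSpace ℝ ι → EuclideanSpace ℝ ι}
    (hA : ∀ k, Measurable (A k)) {σ : ℕ → ℝ} (hσ : ∀ k, 0 < σ k) (x₀ : EuclideanSpace ℝ ι)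
    {h : EuclideanSpace ℝ ι → ℝ} (hc : Continuous h) {b : ℝ} {k : ℕ}
    (hb : ∀ᵐ x ∂gaussianChain A σ x₀ (k + 1), h x ≤ b) (y : EuclideanSpace ℝ ι) : h y ≤ b := by
  have := isProbabilityMeasure_gaussianChain hA σ x₀ k
  by_contra! hy
  have hU : IsOpen {x | b < h x} := isOpen_lt continuous_const hc
  have h0 : gaussianChain A σ x₀ (k + 1) {x | b < h x} = 0 := by
    simpa [ae_iff] using hb
  have hκ : Measurable fun x => gaussianNoise (σ k) (A k x) :=
    (measurable_gaussianNoise _).comp (hA k)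
  have hκU : Measurable fun x => gaussianNoise (σ k) (A k x) {x | b < h x} :=
    (Measure.measurable_coe hU.measurableSet).comp hκ
  rw [gaussianChain, Measure.bind_apply hU.measurableSet hκ.aemeasurable,
    lintegral_eq_zero_iff hκU] at h0
  obtain ⟨x, hx⟩ := h0.exists
  change gaussianNoise (σ k) (A k x) {x | b < h x} = 0 at hx
  rw [gaussianNoise, Measure.map_apply (by fun_prop) hU.measurableSet] at hx
  have hopen : IsOpen ((fun z => A k x + σ k • z) ⁻¹' {x | b < h x}) :=
    hU.preimage (by fun_prop)
  have hemp := hopen.measure_eq_zero_iff (stdGaussian (EuclideanSpace ℝ ι)) |>.1 hx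
  have hmem : (σ k)⁻¹ • (y - A k x) ∈ (fun z => A k x + σ k • z) ⁻¹' {x | b < h x} := by
    simp only [Set.mem_preimage, Set.mem_ofPred_eq, smul_inv_smul₀ (hσ k).ne', add_sub_cancel]
    exact hy
  rw [hemp] at hmem
  exact hmem

end LangevinLaws

/-! ### Sensitivities of the Langevin steps and admissible shifts. -/

section Unlearning

open scoped NNReal ENNReal

variable {ι : Type*} [Fintype ι] {f g : EuclideanSpace ℝ ι → ℝ} {m L η σl σu : ℝ} {T K : ℕ}
  {θ₀ : EuclideanSpace ℝ ι} {s : ℕ → ℝ}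

/-- A step on `f` is a step on `g` plus the gradient discrepancy at `x`, so only the contraction of
the step on `g` is needed. -/
lemma IsStronglyConvexSmooth.norm_langevinDrift_sub_le (hg : IsStronglyConvexSmooth g m L)
    (hη : 0 ≤ η) (k : ℕ) (x y : EuclideanSpace ℝ ι) :
    ‖langevinDrift f g η T k x - langevinDrift g g η T k y‖
      ≤ contractionFactor η m L * ‖x - y‖ + if k < T then ‖η • (∇ g x - ∇ f x)‖ else 0 := by
  have h := hg.norm_gradientStep_sub_le hη x y
  unfold langevinDrift
  split_ifs
  · have e : x - η • ∇ f x - (y - η • ∇ g y)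
        = (x - η • ∇ g x - (y - η • ∇ g y)) + η • (∇ g x - ∇ f x) := by module
    rw [e]
    exact (norm_add_le _ _).trans (add_le_add h le_rfl)
  · simpa using h

lemma exists_sensitivity_and_shift (hm : 0 < m) (hη : 0 < η) (hηL : η < 2 / L)
    (hf : IsStronglyConvexSmooth f m L) (hg : IsStronglyConvexSmooth g m L) (hσl : 0 < σl)
    (hσu : 0 < σu)
    (hs : ∀ k ≤ T, ∀ᵐ x ∂gaussianChain (langevinDrift f g η T) (langevinNoise η σl σu T) θ₀ k,
      ‖η • (∇ g x - ∇ f x)‖ ≤ s k) :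
    ∃ b α : ℕ → ℝ, (∀ k, 0 ≤ α k) ∧
      (∀ k x y, (k = 0 → x = θ₀ ∧ y = θ₀) → ‖langevinDrift f g η T k x - langevinDrift g g η T k y‖
        ≤ contractionFactor η m L * ‖x - y‖ + b k) ∧
      (∀ k ≤ T + K, ∑ j ∈ Finset.Ico k (T + K), contractionFactor η m L ^ (T + K - (j + 1))
        * (b j - α j) ≤ 0) ∧
      ∑ j ∈ Finset.range (T + K), α j ^ 2 / langevinNoise η σl σu T j ^ 2
        ≤ muGDP η σl σu (contractionFactor η m L) T K s ^ 2 := by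
  have hc := contractionFactor_nonneg η m L
  -- Without any discrepancy zero shifts suffice. This disposes of `T = 0` and of the zero space,
  -- where `m ≤ L`, and with it `c ≤ 1`, may fail.
  by_cases htriv : ∀ k x y, ‖langevinDrift f g η T k x - langevinDrift g g η T k y‖
      ≤ contractionFactor η m L * ‖x - y‖
  · exact ⟨fun _ => 0, fun _ => 0, fun _ => le_rfl, fun k x y _ => by simpa using htriv k x y,
      fun k _ => by simp, by simpa using sq_nonneg _⟩
  have hT : 0 < T := by
    refine Nat.pos_of_ne_zero fun h0 => htriv fun k x y => ?_
    simpa [h0] using hg.norm_langevinDrift_sub_le (f := f) (T := T) hη.le k x y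
  have hnt : Nontrivial (EuclideanSpace ℝ ι) := by
    refine not_subsingleton_iff_nontrivial.1 fun hsub => htriv fun k x y => ?_
    rw [Subsingleton.elim (langevinDrift f g η T k x) (langevinDrift g g η T k y), sub_self,
      norm_zero]
    positivity
  obtain ⟨x, y, hxy⟩ := exists_pair_ne (EuclideanSpace ℝ ι)
  have hc1 := contractionFactor_le_one hm (hf.le_of_ne hxy) hη hηL
  have hcont : Continuous fun x => ‖η • (∇ g x - ∇ f x)‖ :=
    ((hg.continuous_gradient.sub hf.continuous_gradient).const_smul η).norm
  have hdrift := measurable_langevinDrift hf.continuous_gradient.measurable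
    hg.continuous_gradient.measurable η T
  -- The index starts at `1`: `θ₀` is deterministic, so `s 0` controls a single point only.
  have hbound : ∀ k, 1 ≤ k → k ≤ T → ∀ x, ‖η • (∇ g x - ∇ f x)‖ ≤ s k := by
    intro k hk1 hkT x
    obtain ⟨k, rfl⟩ := Nat.exists_eq_add_of_le' hk1
    exact le_of_ae_gaussianChain_succ hdrift (fun j => langevinNoise_pos hη hσl hσu T j) θ₀ hcont
      (hs _ hkT) x
  have hbdd : BddAbove (Set.range fun x => ‖η • (∇ g x - ∇ f x)‖) := by
    refine ⟨s 1, ?_⟩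
    rintro _ ⟨x, rfl⟩
    exact hbound 1 le_rfl hT x
  have hstart : ‖η • (∇ g θ₀ - ∇ f θ₀)‖ ≤ s 0 := by
    have h := hs 0 hT.le
    rw [gaussianChain, ae_dirac_iff (measurableSet_le hcont.measurable measurable_const)] at h
    exact h
  obtain ⟨α, hα, htail, hcost⟩ := exists_shift_le_muGDP (K := K) hη hσl hσu hc hc1 hT
    (norm_nonneg (η • (∇ g θ₀ - ∇ f θ₀))) (le_ciSup hbdd θ₀) hstart
    fun k hk1 hkT => ciSup_le (hbound k hk1 hkT)
  refine ⟨_, α, hα, fun k x y h0 => ?_, htail, ?_⟩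
  · refine (hg.norm_langevinDrift_sub_le hη.le k x y).trans (add_le_add le_rfl ?_)
    rcases Nat.eq_zero_or_pos k with rfl | hk
    · rw [(h0 rfl).1]
      simp [hT]
    · rw [if_neg hk.ne']
      split_ifs
      · exact le_ciSup hbdd x
      · exact le_rfl
  · simpa only [sq_langevinNoise hη.le] using hcost

lemma sensitivity_nonneg {E X Y : Type*} [NormedAddCommGroup E] [InnerProductSpace ℝ E]
    [CompleteSpace E] (ℓ : E → X → Y → ℝ) (r : E → ℝ) (lam η : ℝ) {n : ℕ}
    (D : Fin (n + 1) → X × Y) (i : Fin (n + 1)) (θ : E) : 0 ≤ sensitivity ℓ r lam η D i θ :=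
  norm_nonneg _

lemma sensitivity_eq {E X Y : Type*} [NormedAddCommGroup E] [InnerProductSpace ℝ E]
    [CompleteSpace E] {ℓ : E → X → Y → ℝ} {r : E → ℝ} {lam η : ℝ} (hη : 0 ≤ η) {n : ℕ}
    {D : Fin (n + 1) → X × Y} {i : Fin (n + 1)} (hD : Differentiable ℝ (erm ℓ r lam D))
    (hDi : Differentiable ℝ (erm ℓ r lam (i.removeNth D))) (x : E) :
    sensitivity ℓ r lam η D i x = η * ‖∇ (fun y => ℓ y (D i).1 (D i).2) x‖ := by
  have hfun : (fun y => ℓ y (D i).1 (D i).2)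
      = fun y => erm ℓ r lam D y - erm ℓ r lam (i.removeNth D) y := by
    ext y
    simp only [erm, Fin.sum_univ_succAbove _ i, Fin.removeNth]
    ring
  have hgrad : ∇ (fun y => ℓ y (D i).1 (D i).2) x
      = ∇ (erm ℓ r lam D) x - ∇ (erm ℓ r lam (i.removeNth D)) x := by
    rw [hfun]
    refine HasGradientAt.gradient (hasGradientAt_iff_hasFDerivAt.2 ?_)
    rw [map_sub]
    exact (hD x).hasGradientAt.hasFDerivAt.sub (hDi x).hasGradientAt.hasFDerivAt
  rw [sensitivity, norm_smul, Real.norm_of_nonneg hη, norm_sub_rev, hgrad]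

end Unlearning

theorem mainTheorem1
    -- parameter space, with the Euclidean norm (`ι = Fin p × Fin d` gives the matrices with the
    -- Frobenius norm), loss, regularizer, dataset and index of the point to unlearn
    {ι : Type*} [Fintype ι] {p d n : ℕ}
    (ℓ : EuclideanSpace ℝ ι → EuclideanSpace ℝ (Fin p) → EuclideanSpace ℝ (Fin d) → ℝ)
    (r : EuclideanSpace ℝ ι → ℝ) (lam : ℝ) (hlam : 0 < lam)
    (D : Fin (n + 1) → EuclideanSpace ℝ (Fin p) × EuclideanSpace ℝ (Fin d)) (i : Fin (n + 1))
    -- both objectives are strongly convex and smooth, and the step size is admissible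
    (m L η : ℝ) (hm : 0 < m) (hL : 0 < L) (hη : 0 < η) (hηL : η < 2 / L)
    (hfD : IsStronglyConvexSmooth (erm ℓ r lam D) m L)
    (hfDi : IsStronglyConvexSmooth (erm ℓ r lam (i.removeNth D)) m L)
    -- noise levels, horizons and initialization
    (σl σu : ℝ) (hσl : 0 < σl) (hσu : 0 < σu) (T K : ℕ) (θ₀ : EuclideanSpace ℝ ι)
    -- the noises of the two trajectories: two i.i.d. sequences of standard Gaussian vectors
    {Ω : Type*} [MeasurableSpace Ω] (P : Measure Ω) [IsProbabilityMeasure P]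
    (ξ ξ' : ℕ → Ω → EuclideanSpace ℝ ι)
    (hξ : ∀ k, HasLaw (ξ k) (stdGaussian (EuclideanSpace ℝ ι)) P) (hξi : iIndepFun ξ P)
    (hξ' : ∀ k, HasLaw (ξ' k) (stdGaussian (EuclideanSpace ℝ ι)) P) (hξi' : iIndepFun ξ' P)
    -- learning on `D` then unlearning on `D` without its `i`-th point, and retraining
    (θ θ' : ℕ → Ω → EuclideanSpace ℝ ι)
    (hθ : θ = trajectory (erm ℓ r lam D) (erm ℓ r lam (i.removeNth D)) η σl σu T θ₀ ξ)
    (hθ' : θ' = trajectory (erm ℓ r lam (i.removeNth D)) (erm ℓ r lam (i.removeNth D))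
      η σl σu T θ₀ ξ')
    -- deterministic bounds on the per-instance sensitivities along the learning trajectory
    (s : ℕ → ℝ) (hs : ∀ k ≤ T, ∀ᵐ ω ∂P, sensitivity ℓ r lam η D i (θ k ω) ≤ s k)
    (μ : ℝ) (hμ : μ = muGDP η σl σu (contractionFactor η m L) T K s) :
    (∀ x, sensitivity ℓ r lam η D i x = η * ‖∇ (fun y => ℓ y (D i).1 (D i).2) x‖) ∧
    IsGDP μ (P.map (θ (T + K))) (P.map (θ' (T + K))) ∧
    ∀ δ ∈ Set.Ioo (0 : ℝ) 1,
      (∃! ε : ℝ, gdpDelta μ ε = δ) ∧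
      IsPerInstanceUnlearning (learnAlg ℓ r lam η σl T θ₀) (unlearnAlg ℓ r lam η σu K)
        D i (epsGDP μ δ) δ := by
  refine ⟨sensitivity_eq hη.le hfD.1 hfDi.1, ?_⟩
  set f := erm ℓ r lam D with hf_def
  set g := erm ℓ r lam (i.removeNth D) with hg_def
  have hmf := hfD.continuous_gradient.measurable
  have hmg := hfDi.continuous_gradient.measurable
  have hc := contractionFactor_nonneg η m L
  have hs0 : ∀ k ≤ T, 0 ≤ s k := fun k hk => by
    obtain ⟨ω, hω⟩ := (hs k hk).exists
    exact (sensitivity_nonneg ℓ r lam η D i _).trans hω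
  have hμ0 : 0 ≤ μ := hμ ▸ muGDP_nonneg hc hs0
  have hlaw : ∀ k, P.map (θ k)
      = gaussianChain (langevinDrift f g η T) (langevinNoise η σl σu T) θ₀ k := fun k => by
    rw [hθ]
    exact map_trajectory hmf hmg η σl σu T θ₀ hξ hξi k
  have hlaw' : ∀ k, P.map (θ' k)
      = gaussianChain (langevinDrift g g η T) (langevinNoise η σl σu T) θ₀ k := fun k => by
    rw [hθ']
    exact map_trajectory hmg hmg η σl σu T θ₀ hξ' hξi' k
  have hmA := measurable_langevinDrift hmf hmg η T
  have hmB := measurable_langevinDrift hmg hmg η T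
  have hpA := isProbabilityMeasure_gaussianChain hmA (langevinNoise η σl σu T) θ₀
  have hpB := isProbabilityMeasure_gaussianChain hmB (langevinNoise η σl σu T) θ₀
  obtain ⟨b, α, hα, hAB, htail, hcost⟩ := exists_sensitivity_and_shift (T := T) (K := K)
    (θ₀ := θ₀) (s := s) hm hη hηL hfD hfDi hσl hσu fun k hk => by
      have hΔ : Measurable fun x => ‖η • (∇ g x - ∇ f x)‖ := by fun_prop
      -- A map that is not almost everywhere measurable has zero pushforward, whereas this one is a
      -- probability measure.
      have hθk : AEMeasurable (θ k) P := AEMeasurable.of_map_ne_zero (by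
        rw [hlaw k]
        exact (hpA k).ne_zero)
      rw [← hlaw k, ae_map_iff hθk (measurableSet_le hΔ measurable_const)]
      exact hs k hk
  rw [← hμ] at hcost
  have hσ := langevinNoise_pos hη hσl hσu T
  have hPQ : ∀ φ : EuclideanSpace ℝ ι → ℝ, IsTest φ → ∀ ε : ℝ,
      ∫ x, φ x ∂gaussianChain (langevinDrift f g η T) (langevinNoise η σl σu T) θ₀ (T + K)
      ≤ Real.exp ε * ∫ x, φ x
        ∂gaussianChain (langevinDrift g g η T) (langevinNoise η σl σu T) θ₀ (T + K)
        + gdpDelta μ ε := fun φ hφ ε => by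
    have h := hockeyStick_gaussianChain_le_of_contraction hmA hmB hσ hc hα hAB htail hcost hφ
      (Real.exp_pos ε).le
    rw [gaussianHockeyStick_eq_gdpDelta hμ0 rfl] at h
    linarith
  have hQP : ∀ φ : EuclideanSpace ℝ ι → ℝ, IsTest φ → ∀ ε : ℝ,
      ∫ x, φ x ∂gaussianChain (langevinDrift g g η T) (langevinNoise η σl σu T) θ₀ (T + K)
      ≤ Real.exp ε * ∫ x, φ x
        ∂gaussianChain (langevinDrift f g η T) (langevinNoise η σl σu T) θ₀ (T + K)
        + gdpDelta μ ε := fun φ hφ ε => by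
    -- The drift bound is symmetric in the two chains, so the same shifts serve the reverse order.
    have h := hockeyStick_gaussianChain_le_of_contraction hmB hmA hσ hc hα
      (fun k x y h0 => by
        rw [norm_sub_rev, norm_sub_rev x y]
        exact hAB k y x fun hk => (h0 hk).symm) htail hcost hφ (Real.exp_pos ε).le
    rw [gaussianHockeyStick_eq_gdpDelta hμ0 rfl] at h
    linarith
  refine ⟨fun a ha => ?_, fun δ hδ => ⟨existsUnique_gdpDelta_eq hμ0 hδ, fun S hS => ?_⟩⟩
  · rw [hlaw, hlaw']
    exact ⟨gaussianTradeOff_le_tradeOff hμ0 hQP ha, gaussianTradeOff_le_tradeOff hμ0 hPQ ha⟩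
  · have h := hPQ _ (isTest_indicator hS) (epsGDP μ δ)
    have hind : ∀ Q : Measure (EuclideanSpace ℝ ι),
        ∫ x, S.indicator (fun _ => (1 : ℝ)) x ∂Q = Q.real S := fun Q => integral_indicator_one hS
    rw [hind, hind, gdpDelta_epsGDP hμ0 hδ, ← bind_langevinLaw f hmg,
      ← bind_langevinLaw g hmg] at h
    exact h
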